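/- **Syntax.** Let $\mathcal A$ be a set of atoms and $\mathcal S$ a set of standpoint names containing the universal standpoint $\ast$. Formulas are given by $\psi ::= p \mid \neg\psi \mid \psi_1\wedge\psi_2 \mid \Box_s\psi$ with $p\in\mathcal A$, $s\in\mathcal S$. Expressions are formulas and sharpening statements $s\preccurlyeq u$ with $s,u\in\mathcal S$. A theory is a set of expressions. **Semantics.** An S4F standpoint structure $\mathfrak F=(\Pi,\sigma,\tau,\gamma)$ consists of a non-empty set $\Pi$ of precisifications, maps $\sigma,\tau:\mathcal S\to 2^{\Pi}$ with $\sigma(\ast)\cup\tau(\ast)=\Pi$ and, for all $s,u\in\mathcal S$, $\sigma(s)\neq\emptyset$ and $\sigma(s)\cap\tau(u)=\emptyset$, and a map $\gamma:\Pi\to 2^{\mathcal A}$. Satisfaction at $\pi\in\Pi$ is defined by: - $\mathfrak F,\pi\Vdash p$ iff $p\in\gamma(\pi)$; the connectives $\neg,\wedge$ are read as usual; - $\mathfrak F,\pi\Vdash\Box_s\psi$ iff $\mathfrak F,\pi'\Vdash\psi$ for all $\pi'\in\sigma(s)$ in case $\pi\in\sigma(\ast)$, and for all $\pi'\in\sigma(s)\cup\tau(s)$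 otherwise; - $\mathfrak F,\pi\Vdash s\preccurlyeq u$ iff $\sigma(s)\subseteq\sigma(u)$ and $\tau(s)\subseteq\tau(u)$. Moreover $\mathfrak F\Vdash\varphi$ iff $\mathfrak F,\pi\Vdash\varphi$ for all $\pi\in\Pi$. For a theory $T$, $\mathfrak F\Vdash T$ (respectively $\mathfrak F,\pi\Vdash T$) iff $\mathfrak F\Vdash\varphi$ (respectively $\mathfrak F,\pi\Vdash\varphi$) for all $\varphi\in T$. **Problem.** An instance of the model checking problem consists of a structure $\mathfrak F$ with finitely many atoms, standpoint names and precisifications, a query over the same vocabulary that is either a single expression $\varphi$ or a finite theory $T$, and optionally a precisification $\pi\in\Pi$. The question is whether $\mathfrak F\Vdash\varphi$ (respectively $\mathfrak F\Vdash T$), or, if $\pi$ is given, whether $\mathfrak F,\pi\Vdash\varphi$ (respectively $\mathfrak F,\pi\Vdash T$). Instances are written as words over a fixed finite alphabet: atoms, standpoint names and precisifications are numbered, with indices in binary; $\sigma,\tau,\gamma$ are given as bit tables; formulas are written out as strings in Polish notation; and a finite theory is given as a list of its members. **Proposition.** The model checking problem for S4F standpoint logic (for formulas and for finite theories, with or without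 a given precisification) is in $\mathsf P$: the language of all words that represent an instance with a positive answer is decided by a deterministic Turing machine in time polynomial in the length of the input word. -/

import Mathlib

namespace S4FStandpoint

/-! ### Syntax -/

/-- Formulas of propositional multi-modal logic over atoms `A` and standpoint names `S`;
`box s ψ` is the modality `□_s ψ`. -/
inductive Formula (A S : Type) : Type
  | atom (p : A) : Formula A S
  | neg (ψ : Formula A S) : Formula A S
  | conj (ψ₁ ψ₂ : Formula A S) : Formula A S
  | box (s : S) (ψ : Formula A S) : Formula A S

/-- Expressions of S4F standpoint logic: sharpening statements `s ≼ u` and formulas.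
A theory is a set of expressions. -/
inductive Expression (A S : Type) : Type
  | sharpening (s u : S) : Expression A S
  | formula (ψ : Formula A S) : Expression A S

/-! ### Semantics -/

/-- An S4F standpoint structure over atoms `A` and standpoint names `S`, with universal standpoint
`star` and set of precisifications `P`: every standpoint name has inner precisifications `σ`
and outer precisifications `τ`, and `γ` is the valuation of each precisification. -/
structure StandpointStructure (A S : Type) (star : S) (P : Type) where
  nonempty : Nonempty P
  σ : S → Set P
  τ : S → Set P
  γ : P → Set A
  star_universal : σ star ∪ τ star = Set.univ
  inner_nonempty : ∀ s, (σ s).Nonempty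
  inner_outer_disjoint : ∀ s u, σ s ∩ τ u = ∅

variable {A S P : Type} {star : S}

namespace StandpointStructure

/-- Pointed satisfaction `F, π ⊩ ψ` of formulas. -/
def SatFormula (F : StandpointStructure A S star P) : P → Formula A S → Prop
  | π, .atom p => p ∈ F.γ π
  | π, .neg ψ => ¬ F.SatFormula π ψ
  | π, .conj ψ₁ ψ₂ => F.SatFormula π ψ₁ ∧ F.SatFormula π ψ₂
  | π, .box s ψ =>
      (π ∈ F.σ star → ∀ π' ∈ F.σ s, F.SatFormula π' ψ) ∧
      (π ∉ F.σ star → ∀ π' ∈ F.σ s ∪ F.τ s, F.SatFormula π' ψ)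

/-- Pointed satisfaction `F, π ⊩ φ` of expressions. -/
def Sat (F : StandpointStructure A S star P) (π : P) : Expression A S → Prop
  | .sharpening s u => F.σ s ⊆ F.σ u ∧ F.τ s ⊆ F.τ u
  | .formula ψ => F.SatFormula π ψ

/-- Global satisfaction `F ⊩ φ`. -/
def Models (F : StandpointStructure A S star P) (φ : Expression A S) : Prop :=
  ∀ π, F.Sat π φ

/-- `F` is a model of the theory `T`. -/
def ModelsTheory (F : StandpointStructure A S star P) (T : Set (Expression A S)) : Prop :=
  ∀ φ ∈ T, F.Models φ

/-- All members of the theory `T` are satisfied at the precisification `π`. -/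
def SatTheory (F : StandpointStructure A S star P) (π : P) (T : Set (Expression A S)) : Prop :=
  ∀ φ ∈ T, F.Sat π φ

end StandpointStructure

/-! ### Instances of the model checking problem -/

/-- What is to be checked: a single expression, or the finite theory whose members are listed. -/
inductive Query (A S : Type) : Type
  | single (φ : Expression A S) : Query A S
  | theory (T : List (Expression A S)) : Query A S

/-- An instance of model checking: a finite structure over a finite vocabulary, a query over that
vocabulary, and possibly a precisification.  Atoms, standpoint names and precisifications are
numbered from `0`; the universal standpoint has number `0`. -/
structure ModelCheckingInstance where
  numAtoms : ℕ
  /-- the number of standpoint names other than the universal standpoint -/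
  numNames : ℕ
  numPrecs : ℕ
  F : StandpointStructure (Fin numAtoms) (Fin (numNames + 1)) 0 (Fin numPrecs)
  query : Query (Fin numAtoms) (Fin (numNames + 1))
  point : Option (Fin numPrecs)

/-- The instance has a positive answer. -/
def ModelCheckingInstance.Holds (x : ModelCheckingInstance) : Prop :=
  match x.query, x.point with
  | .single φ, some π => x.F.Sat π φ
  | .single φ, none => x.F.Models φ
  | .theory T, some π => x.F.SatTheory π {φ | φ ∈ T}
  | .theory T, none => x.F.ModelsTheory {φ | φ ∈ T}

/-! ### Writing instances as words

Sets are written as rows of bits (one bit for each candidate element), indices in binary, and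
formulas in Polish notation. -/

/-- The input alphabet. -/
inductive Symbol : Type
  | bit (b : Bool)
  | sep
  | close
  | atom
  | neg
  | conj
  | box
  | sharpening
  | single
  | theory
  | everywhere
  | at
  deriving DecidableEq, Fintype

/-- A bit string, terminated by `sep`. -/
def encBits (l : List Bool) : List Symbol := l.map .bit ++ [.sep]

/-- A natural number in binary. -/
def encNat (n : ℕ) : List Symbol := encBits (Computability.encodeNat n)

/-- A list of bit strings, terminated by `close`. -/
def encRows (l : List (List Bool)) : List Symbol := l.flatMap encBits ++ [.close]

/-- The characteristic bit string of a subset of `Fin n`. -/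
noncomputable def bitRow {n : ℕ} (X : Set (Fin n)) : List Bool :=
  open Classical in List.ofFn fun i => decide (i ∈ X)

/-- A family of `m` subsets of `Fin n`. -/
noncomputable def encFamily {m n : ℕ} (X : Fin m → Set (Fin n)) : List Symbol :=
  encRows (List.ofFn fun i => bitRow (X i))

variable {a s p : ℕ}

noncomputable def encStructure (F : StandpointStructure (Fin a) (Fin (s + 1)) 0 (Fin p)) :
    List Symbol :=
  encFamily F.σ ++ encFamily F.τ ++ encFamily F.γ

def encFormula : Formula (Fin a) (Fin s) → List Symbol
  | .atom p => .atom :: encNat p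
  | .neg ψ => .neg :: encFormula ψ
  | .conj ψ₁ ψ₂ => .conj :: (encFormula ψ₁ ++ encFormula ψ₂)
  | .box t ψ => .box :: (encNat t ++ encFormula ψ)

def encExpression : Expression (Fin a) (Fin s) → List Symbol
  | .sharpening t u => .sharpening :: (encNat t ++ encNat u)
  | .formula ψ => encFormula ψ

def encQuery : Query (Fin a) (Fin s) → List Symbol
  | .single φ => .single :: encExpression φ
  | .theory T => .theory :: (T.flatMap encExpression ++ [.close])

def encPoint : Option (Fin p) → List Symbol
  | none => [.everywhere]
  | some π => .at :: encNat π

/-- The word that represents an instance. -/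
noncomputable def ModelCheckingInstance.encode (x : ModelCheckingInstance) : List Symbol :=
  encStructure x.F ++ encPoint x.point ++ encQuery x.query

/-! The encoding is unambiguous. -/

theorem encBits_cancel {l l' : List Bool} {r r' : List Symbol}
    (h : encBits l ++ r = encBits l' ++ r') : l = l' ∧ r = r' := by
  induction l generalizing l' with
  | nil => cases l' <;> simp_all [encBits]
  | cons b l ih =>
    cases l' with
    | nil => simp [encBits] at h
    | cons b' l' =>
      simp only [encBits, List.map_cons, List.cons_append, List.cons.injEq, Symbol.bit.injEq] at h
      obtain ⟨h1, h2⟩ := ih h.2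
      exact ⟨by rw [h.1, h1], h2⟩

theorem encNat_cancel {m n : ℕ} {r r' : List Symbol}
    (h : encNat m ++ r = encNat n ++ r') : m = n ∧ r = r' := by
  obtain ⟨h1, h2⟩ := encBits_cancel h
  refine ⟨?_, h2⟩
  rw [← Computability.decode_encodeNat m, h1, Computability.decode_encodeNat]

theorem encRows_cancel {l l' : List (List Bool)} {r r' : List Symbol}
    (h : encRows l ++ r = encRows l' ++ r') : l = l' ∧ r = r' := by
  have key : ∀ (b : List Bool) (t : List Symbol), Symbol.close :: r ≠ encBits b ++ t := by
    intro b t; cases b <;> simp [encBits]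
  have key' : ∀ (b : List Bool) (t : List Symbol), encBits b ++ t ≠ Symbol.close :: r' := by
    intro b t; cases b <;> simp [encBits]
  induction l generalizing l' with
  | nil =>
    cases l' with
    | nil => simpa [encRows] using h
    | cons b' l' => exact absurd (by simpa [encRows] using h) (key _ _)
  | cons b l ih =>
    cases l' with
    | nil => exact absurd (by simpa [encRows] using h) (key' _ _)
    | cons b' l' =>
      simp only [encRows, List.flatMap_cons, List.append_assoc] at h
      obtain ⟨h1, h2⟩ := encBits_cancel h
      obtain ⟨h3, h4⟩ := ih (l' := l') (by simpa [encRows] using h2)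
      exact ⟨by rw [h1, h3], h4⟩

theorem bitRow_injective {n : ℕ} : Function.Injective (bitRow (n := n)) := by
  intro X Y h
  ext i
  simpa using congrFun (List.ofFn_injective h) i

theorem encFamily_cancel {m n m' n' : ℕ} {X : Fin m → Set (Fin n)} {Y : Fin m' → Set (Fin n')}
    {r r' : List Symbol} (h : encFamily X ++ r = encFamily Y ++ r') :
    m = m' ∧ (0 < m → n = n') ∧ r = r' := by
  obtain ⟨h1, h2⟩ := encRows_cancel h
  have hm : m = m' := by simpa using congrArg List.length h1
  subst hm
  refine ⟨rfl, fun hm => ?_, h2⟩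
  have h3 := congrFun (List.ofFn_injective h1) ⟨0, hm⟩
  simpa [bitRow] using congrArg List.length h3

theorem encFamily_cancel' {m n : ℕ} {X Y : Fin m → Set (Fin n)}
    {r r' : List Symbol} (h : encFamily X ++ r = encFamily Y ++ r') : X = Y ∧ r = r' := by
  obtain ⟨h1, h2⟩ := encRows_cancel h
  exact ⟨funext fun i => bitRow_injective (congrFun (List.ofFn_injective h1) i), h2⟩

theorem encFormula_cancel {ψ ψ' : Formula (Fin a) (Fin s)} {r r' : List Symbol}
    (h : encFormula ψ ++ r = encFormula ψ' ++ r') : ψ = ψ' ∧ r = r' := by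
  induction ψ generalizing ψ' r r' with
  | atom p =>
    cases ψ' <;> simp [encFormula] at h
    obtain ⟨h1, h2⟩ := encNat_cancel h
    exact ⟨by rw [Fin.ext h1], h2⟩
  | neg ψ ih =>
    cases ψ' <;> simp [encFormula] at h
    obtain ⟨h1, h2⟩ := ih h
    exact ⟨by rw [h1], h2⟩
  | conj ψ₁ ψ₂ ih₁ ih₂ =>
    cases ψ' <;> simp [encFormula] at h
    obtain ⟨h1, h2⟩ := ih₁ h
    obtain ⟨h3, h4⟩ := ih₂ h2
    exact ⟨by rw [h1, h3], h4⟩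
  | box t ψ ih =>
    cases ψ' <;> simp [encFormula] at h
    obtain ⟨h1, h2⟩ := encNat_cancel h
    obtain ⟨h3, h4⟩ := ih h2
    exact ⟨by rw [Fin.ext h1, h3], h4⟩

theorem encExpression_cancel {φ φ' : Expression (Fin a) (Fin s)} {r r' : List Symbol}
    (h : encExpression φ ++ r = encExpression φ' ++ r') : φ = φ' ∧ r = r' := by
  cases φ with
  | sharpening t u =>
    cases φ' with
    | sharpening t' u' =>
      simp [encExpression] at h
      obtain ⟨h1, h2⟩ := encNat_cancel h
      obtain ⟨h3, h4⟩ := encNat_cancel h2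
      exact ⟨by rw [Fin.ext h1, Fin.ext h3], h4⟩
    | formula ψ' => cases ψ' <;> simp [encExpression, encFormula] at h
  | formula ψ =>
    cases φ' with
    | sharpening t' u' => cases ψ <;> simp [encExpression, encFormula] at h
    | formula ψ' =>
      obtain ⟨h1, h2⟩ := encFormula_cancel h
      exact ⟨by rw [h1], h2⟩

theorem encExpression_ne_close (φ : Expression (Fin a) (Fin s)) (r r' : List Symbol) :
    encExpression φ ++ r ≠ .close :: r' := by
  cases φ with
  | sharpening => simp [encExpression]
  | formula ψ => cases ψ <;> simp [encExpression, encFormula]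

theorem encQuery_injective : Function.Injective (encQuery (a := a) (s := s)) := by
  intro q q' h
  cases q with
  | single φ =>
    cases q' with
    | single φ' =>
      have h1 : encExpression φ = encExpression φ' := by simpa [encQuery] using h
      have h2 : encExpression φ ++ [] = encExpression φ' ++ [] := by rw [h1]
      rw [(encExpression_cancel h2).1]
    | theory => simp [encQuery] at h
  | theory T =>
    cases q' with
    | single => simp [encQuery] at h
    | theory T' =>
      have h1 : T.flatMap encExpression ++ [.close] = T'.flatMap encExpression ++ [.close] := by
        simpa [encQuery] using h
      clear h
      congr 1
      induction T generalizing T' with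
      | nil =>
        cases T' with
        | nil => rfl
        | cons φ' T' =>
          simp only [List.flatMap_cons, List.append_assoc] at h1
          exact absurd h1.symm (encExpression_ne_close _ _ _)
      | cons φ T ih =>
        cases T' with
        | nil =>
          simp only [List.flatMap_cons, List.append_assoc] at h1
          exact absurd h1 (encExpression_ne_close _ _ _)
        | cons φ' T' =>
          simp only [List.flatMap_cons, List.append_assoc] at h1
          obtain ⟨h2, h3⟩ := encExpression_cancel h1
          rw [h2, ih T' h3]

theorem encPoint_cancel {π π' : Option (Fin p)} {r r' : List Symbol}
    (h : encPoint π ++ r = encPoint π' ++ r') : π = π' ∧ r = r' := by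
  cases π <;> cases π' <;> simp [encPoint] at h
  · exact ⟨rfl, h⟩
  · obtain ⟨h1, h2⟩ := encNat_cancel h
    exact ⟨by rw [Fin.ext h1], h2⟩

theorem ModelCheckingInstance.encode_injective :
    Function.Injective ModelCheckingInstance.encode := by
  rintro ⟨a, s, p, F, q, π⟩ ⟨a', s', p', F', q', π'⟩ h
  simp only [encode, encStructure, List.append_assoc] at h
  obtain ⟨hs, hp, h2⟩ := encFamily_cancel h
  obtain rfl : s = s' := by omega
  obtain rfl : p = p' := hp (by omega)
  obtain ⟨-, -, h3⟩ := encFamily_cancel h2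
  obtain ⟨-, ha, -⟩ := encFamily_cancel h3
  obtain rfl : a = a' := ha (by obtain ⟨i⟩ := F.nonempty; exact i.pos)
  obtain ⟨e1, h⟩ := encFamily_cancel' h
  obtain ⟨e2, h⟩ := encFamily_cancel' h
  obtain ⟨e3, h⟩ := encFamily_cancel' h
  obtain ⟨e4, e5⟩ := encPoint_cancel h
  replace e5 := encQuery_injective e5
  cases F; cases F'
  simp only at e1 e2 e3
  subst e1 e2 e3 e4 e5
  rfl

/-! ### The complexity class and the problem -/

/-- The class `P` of languages over a finite alphabet `Γ`: those decided by a multi-stack Turing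
machine which on every word `w` over `Γ` halts with output `true` if `w` is in the language and
`false` otherwise, within a number of steps bounded by a polynomial in the length of `w`. -/
def ClassP (Γ : Type) [Fintype Γ] : Set (Language Γ) :=
  {L | Nonempty (Turing.TM2ComputableInPolyTime (id : List Γ → List Γ) Computability.encodeBool
    (fun w => open Classical in decide (w ∈ L)))}

/-- The model checking problem: the language of all words that represent an instance with a
positive answer. -/
def modelCheckingProblem : Language Symbol :=
  {w | ∃ x : ModelCheckingInstance, x.encode = w ∧ x.Holds}

end S4FStandpoint

/-! Model checking is bottom-up labelling. The set of precisifications satisfying a subformula is a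
row of bits, computed from the rows of its immediate subformulas. For `□_s ψ` only two inclusions
matter, of `σ s` and of `τ s` in the row of `ψ`, and the second is ignored at inner precisifications
of the universal standpoint; a sharpening statement is again two inclusions. Polish notation is
evaluated from right to left with a stack of rows (`evalTokens_encFormula`), so every symbol of the
query costs polynomial time in the size of the tables.

The language contains only words that represent instances, so every other word has to be rejected.
Acceptance is therefore inverted: tables that pass the tests come from a structure
(`exists_of_validTables`), and a successful evaluation factors the word into bit strings and
expressions (`exists_of_evalTokens`). Together these give `mem_modelCheckingProblem_iff`.

The rest exhibits a machine. Structured stack programs compile to `TM2` code step for step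
(`Prog.Run.iterate_step`). Data are binary trees in self-delimiting prefix notation on one stack,
and `Poly f` says that a program replaces the code of `x` by that of `f x` in polynomial time, with
output of polynomial size. Such functions are closed under composition, pairing, case distinction,
and folds whose accumulator grows only additively (`Poly.foldl`). With these closure rules given to
`fun_prop`, the running time of the procedure reduces to estimates of accumulators, above all
`sz_evalStep_le`. Finally `mem_classP` adds the reading of the input and the writing of the answer.
-/

/-! ### Structured programs over finitely many stacks, and their compilation to Turing machines -/

namespace PolyTime

open Turing

/-- Structured programs operating on a family of stacks and on a register with values in `σ`. -/
inductive Prog (K : Type) (Γ : K → Type) (σ : Type) : Type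
  | push (k : K) (f : σ → Γ k) : Prog K Γ σ
  | pop (k : K) (f : σ → Option (Γ k) → σ) : Prog K Γ σ
  | load (f : σ → σ) : Prog K Γ σ
  | seq (p q : Prog K Γ σ) : Prog K Γ σ
  | switch (f : σ → Prog K Γ σ) : Prog K Γ σ
  | loop (c : σ → Bool) (p : Prog K Γ σ) : Prog K Γ σ

namespace Prog

variable {K : Type} {Γ : K → Type} {σ : Type}

/-- The control points of a program. -/
def Label : Prog K Γ σ → Type
  | push _ _ => Unit
  | pop _ _ => Unit
  | load _ => Unit
  | seq p q => p.Label ⊕ q.Label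
  | switch f => Option (Σ s, (f s).Label)
  | loop _ p => Option p.Label

/-- Finiteness of the register type is needed here: `switch` contains a subprogram for every
register value. -/
noncomputable instance fintypeLabel [Fintype σ] : ∀ p : Prog K Γ σ, Fintype p.Label
  | push _ _ => inferInstanceAs (Fintype Unit)
  | pop _ _ => inferInstanceAs (Fintype Unit)
  | load _ => inferInstanceAs (Fintype Unit)
  | seq p q =>
    have := fintypeLabel p
    have := fintypeLabel q
    inferInstanceAs (Fintype (p.Label ⊕ q.Label))
  | switch f =>
    have := fun s => fintypeLabel (f s)
    inferInstanceAs (Fintype (Option (Σ s, (f s).Label)))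
  | loop _ p =>
    have := fintypeLabel p
    inferInstanceAs (Fintype (Option p.Label))

/-- The control point at which the execution of a program starts. -/
def entry : ∀ p : Prog K Γ σ, p.Label
  | push _ _ => ()
  | pop _ _ => ()
  | load _ => ()
  | seq p _ => Sum.inl p.entry
  | switch _ => none
  | loop _ _ => none

/-- The machine code of a program whose control points are embedded into `Λ` and which continues
at `exit`. -/
def code {Λ : Type} : ∀ p : Prog K Γ σ, (p.Label → Λ) → Λ → p.Label → TM2.Stmt Γ Λ σ
  | push k f, _, exit, _ => .push k f (.goto fun _ => exit)
  | pop k f, _, exit, _ => .pop k f (.goto fun _ => exit)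
  | load f, _, exit, _ => .load f (.goto fun _ => exit)
  | seq p q, emb, _, Sum.inl l => p.code (fun l => emb (Sum.inl l)) (emb (Sum.inr q.entry)) l
  | seq _ q, emb, exit, Sum.inr l => q.code (fun l => emb (Sum.inr l)) exit l
  | switch f, emb, _, none => .goto fun s => emb (some ⟨s, (f s).entry⟩)
  | switch f, emb, exit, some ⟨s, l⟩ => (f s).code (fun l => emb (some ⟨s, l⟩)) exit l
  | loop c p, emb, exit, none => .goto fun s => if c s then emb (some p.entry) else exit
  | loop _ p, emb, _, some l => p.code (fun l => emb (some l)) (emb none) l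

variable [DecidableEq K]

/-- `Run p (v, S) n (v', S')`: started with register `v` and stacks `S`, the program `p`
terminates after `n` steps with register `v'` and stacks `S'`. -/
inductive Run : Prog K Γ σ → σ × (∀ k, List (Γ k)) → ℕ → σ × (∀ k, List (Γ k)) → Prop
  | push (k f v S) : Run (push k f) (v, S) 1 (v, Function.update S k (f v :: S k))
  | pop (k f v S) : Run (pop k f) (v, S) 1 (f v (S k).head?, Function.update S k (S k).tail)
  | load (f v S) : Run (load f) (v, S) 1 (f v, S)
  | seq {p q s₁ m s₂ n s₃} : Run p s₁ m s₂ → Run q s₂ n s₃ → Run (seq p q) s₁ (m + n) s₃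
  | switch {f s n s'} : Run (f s.1) s n s' → Run (switch f) s (n + 1) s'
  | loop_done {c p s} : c s.1 = false → Run (loop c p) s 1 s
  | loop_step {c p s₁ m s₂ n s₃} : c s₁.1 = true → Run p s₁ m s₂ → Run (loop c p) s₂ n s₃ →
      Run (loop c p) s₁ (m + n + 1) s₃

/-- A subprogram sees the surrounding machine only through `emb` and `exit`, so the claim is made
for every machine that agrees with the code on the image of `emb`; the induction hypotheses then
apply to the components with their own embeddings and exits. Step counts are exact, each `switch`
and each loop test being one transition. -/
theorem Run.iterate_step {Λ : Type} {M : Λ → TM2.Stmt Γ Λ σ} {p : Prog K Γ σ}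
    {s : σ × (∀ k, List (Γ k))} {n : ℕ} {s' : σ × (∀ k, List (Γ k))} (h : Run p s n s')
    (emb : p.Label → Λ) (exit : Λ) (hM : ∀ l, M (emb l) = p.code emb exit l) :
    (flip bind (TM2.step M))^[n] (some ⟨some (emb p.entry), s.1, s.2⟩) =
      some ⟨some exit, s'.1, s'.2⟩ := by
  have one : ∀ (l l' : Λ) (s s' : σ × (∀ k, List (Γ k))),
      TM2.stepAux (M l) s.1 s.2 = ⟨some l', s'.1, s'.2⟩ →
      flip bind (TM2.step M) (some ⟨some l, s.1, s.2⟩) = some ⟨some l', s'.1, s'.2⟩ := by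
    intro l l' s s' h
    simp [flip, h]
  induction h generalizing exit with
  | push k f v S =>
    exact one _ _ (v, S) (v, _) (by rw [hM]; simp [code])
  | pop k f v S =>
    exact one _ _ (v, S) (f v _, _) (by rw [hM]; simp [code])
  | load f v S =>
    exact one _ _ (v, S) (f v, _) (by rw [hM]; simp [code])
  | @seq p q s₁ m s₂ n s₃ _ _ ih₁ ih₂ =>
    -- `iterate_add_apply` performs the right summand first, so the run of `p` has to stand on the
    -- right.
    rw [Nat.add_comm, Function.iterate_add_apply]
    have e₁ := ih₁ (fun l => emb (Sum.inl l)) (emb (Sum.inr q.entry)) fun l => hM (Sum.inl l)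
    have e₂ := ih₂ (fun l => emb (Sum.inr l)) exit (fun l => hM (Sum.inr l))
    rw [show (Prog.seq p q).entry = Sum.inl p.entry from rfl, e₁, e₂]
  | @switch f s n s' _ ih =>
    rw [Function.iterate_add_apply, Function.iterate_one,
      one _ (emb (some ⟨s.1, (f s.1).entry⟩)) s s (by rw [hM]; simp [code, entry])]
    exact ih (fun l => emb (some ⟨s.1, l⟩)) exit (fun l => hM (some ⟨s.1, l⟩))
  | @loop_done c p s hc =>
    exact one _ _ s s (by rw [hM]; simp [code, entry, hc])
  | @loop_step c p s₁ m s₂ n s₃ hc _ _ ih₁ ih₂ =>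
    rw [Function.iterate_add_apply, Function.iterate_one,
      one _ (emb (some p.entry)) s₁ s₁ (by rw [hM]; simp [code, entry, hc]),
      Nat.add_comm, Function.iterate_add_apply]
    have e₁ := ih₁ (fun l => emb (some l)) (emb none) (fun l => hM (some l))
    rw [e₁]
    exact ih₂ emb exit hM

/-- `RunLE p s n s'`: started in `s`, the program `p` terminates in `s'` after at most `n`
steps. -/
def RunLE (p : Prog K Γ σ) (s : σ × (∀ k, List (Γ k))) (n : ℕ) (s' : σ × (∀ k, List (Γ k))) :
    Prop :=
  ∃ m ≤ n, Run p s m s'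

theorem Run.le {p : Prog K Γ σ} {s s' : σ × (∀ k, List (Γ k))} {n : ℕ} (h : Run p s n s') :
    RunLE p s n s' :=
  ⟨n, le_rfl, h⟩

theorem RunLE.mono {p : Prog K Γ σ} {s s' : σ × (∀ k, List (Γ k))} {m n : ℕ}
    (h : RunLE p s m s') (hmn : m ≤ n) : RunLE p s n s' := by
  obtain ⟨k, hk, h⟩ := h
  exact ⟨k, hk.trans hmn, h⟩

theorem RunLE.seq {p q : Prog K Γ σ} {s₁ s₂ s₃ : σ × (∀ k, List (Γ k))} {m n : ℕ}
    (h₁ : RunLE p s₁ m s₂) (h₂ : RunLE q s₂ n s₃) : RunLE (p.seq q) s₁ (m + n) s₃ := by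
  obtain ⟨k, hk, h₁⟩ := h₁
  obtain ⟨l, hl, h₂⟩ := h₂
  exact ⟨k + l, by omega, h₁.seq h₂⟩

theorem RunLE.switch {f : σ → Prog K Γ σ} {s s' : σ × (∀ k, List (Γ k))} {n : ℕ}
    (h : RunLE (f s.1) s n s') : RunLE (switch f) s (n + 1) s' := by
  obtain ⟨k, hk, h⟩ := h
  exact ⟨k + 1, by omega, h.switch⟩

theorem RunLE.loop_done {c : σ → Bool} (p : Prog K Γ σ) {s : σ × (∀ k, List (Γ k))}
    (h : c s.1 = false) : RunLE (loop c p) s 1 s :=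
  (Run.loop_done h).le

theorem RunLE.loop_step {c : σ → Bool} {p : Prog K Γ σ} {s₁ s₂ s₃ : σ × (∀ k, List (Γ k))}
    {m n : ℕ} (h : c s₁.1 = true) (h₁ : RunLE p s₁ m s₂) (h₂ : RunLE (loop c p) s₂ n s₃) :
    RunLE (loop c p) s₁ (m + n + 1) s₃ := by
  obtain ⟨k, hk, h₁⟩ := h₁
  obtain ⟨l, hl, h₂⟩ := h₂
  exact ⟨k + l + 1, by omega, Run.loop_step h h₁ h₂⟩

end Prog

end PolyTime

/-! ### Manipulation of serialized trees on a stack -/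

namespace PolyTime

/-- Binary trees. -/
inductive Tree : Type
  | nil : Tree
  | node (l r : Tree) : Tree

namespace Tree

/-- The serialization of a tree in prefix notation. -/
def ser : Tree → List Bool
  | nil => [false]
  | node l r => true :: (l.ser ++ r.ser)

/-- The length of the serialization of a tree. -/
def size (t : Tree) : ℕ := t.ser.length

@[simp] theorem size_nil : nil.size = 1 := rfl

@[simp] theorem size_node (l r : Tree) : (node l r).size = l.size + r.size + 1 := by
  simp [size, ser]

@[simp] theorem length_ser (t : Tree) : t.ser.length = t.size := rfl

theorem size_pos (t : Tree) : 0 < t.size := by cases t <;> simp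

end Tree

/-- The work stacks. -/
inductive Work : Type
  | a
  | b
  | c
  | d
  deriving DecidableEq

instance : Fintype Work := ⟨{.a, .b, .c, .d}, fun k => by cases k <;> simp⟩

/-- The stacks: an input stack and the work stacks. -/
inductive Stack : Type
  | input
  | work (k : Work)
  deriving DecidableEq, Fintype

/-- The stack alphabets. -/
def StackSymbol (I : Type) : Stack → Type
  | .input => I
  | .work _ => Bool

/-- Programs with input alphabet `I`; the register holds the symbol that was popped last from the
input stack and the one that was popped last from a work stack. -/
abbrev WordProg (I : Type) := Prog Stack (StackSymbol I) (Option I × Option Bool)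

variable {I : Type}

/-- The contents of all stacks. -/
def allStacks (i : List I) (w : Work → List Bool) : ∀ k, List (StackSymbol I k)
  | .input => i
  | .work k => w k

theorem update_allStacks_work (i : List I) (w : Work → List Bool) (k : Work) (l : List Bool) :
    Function.update (allStacks i w) (.work k) l = allStacks i (Function.update w k l) := by
  funext k'
  cases k' with
  | input => rfl
  | work k' =>
    by_cases h : k' = k
    · subst h
      exact (Function.update_self (β := fun k => List (StackSymbol I k)) _ _ _).trans
        (Function.update_self k' l w).symm
    · exact (Function.update_of_ne (β := fun k => List (StackSymbol I k))
        (by simpa using h) _ _).trans (Function.update_of_ne (β := fun _ => List Bool) h l w).symm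

theorem update_allStacks_input (i i' : List I) (w : Work → List Bool) :
    Function.update (allStacks i w) .input i' = allStacks i' w := by
  funext k'
  cases k' with
  | input => exact Function.update_self (β := fun k => List (StackSymbol I k)) _ _ _
  | work k' => exact Function.update_of_ne (β := fun k => List (StackSymbol I k)) (by simp) _ _

/-- The contents of the four work stacks. -/
def work (a b c d : List Bool) : Work → List Bool
  | .a => a
  | .b => b
  | .c => c
  | .d => d

section work

variable (a b c d l : List Bool)

@[simp] theorem work_a : work a b c d .a = a := rfl
@[simp] theorem work_b : work a b c d .b = b := rfl
@[simp] theorem work_c : work a b c d .c = c := rfl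
@[simp] theorem work_d : work a b c d .d = d := rfl

@[simp] theorem update_work_a : Function.update (work a b c d) .a l = work l b c d := by
  funext k; cases k <;> simp [work]
@[simp] theorem update_work_b : Function.update (work a b c d) .b l = work a l c d := by
  funext k; cases k <;> simp [work]
@[simp] theorem update_work_c : Function.update (work a b c d) .c l = work a b l d := by
  funext k; cases k <;> simp [work]
@[simp] theorem update_work_d : Function.update (work a b c d) .d l = work a b c l := by
  funext k; cases k <;> simp [work]

end work

/-- `RunW p o w n o' w'`: started with the work register `o` and the work stacks `w`, the program
`p` terminates after at most `n` steps with `o'` and `w'`, and leaves the input alone. -/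
def RunW (p : WordProg I) (o : Option Bool) (w : Work → List Bool) (n : ℕ) (o' : Option Bool)
    (w' : Work → List Bool) : Prop :=
  ∀ v i, p.RunLE ((v, o), allStacks i w) n ((v, o'), allStacks i w')

/-- Pop from a work stack into the register. -/
def popW (k : Work) : WordProg I := .pop (.work k) fun r o => (r.1, o)

/-- Push a bit that depends on the register. -/
def pushW (k : Work) (f : Option Bool → Bool) : WordProg I := .push (.work k) fun r => f r.2

/-- Load a bit into the register. -/
def loadW (o : Option Bool) : WordProg I := .load fun r => (r.1, o)

/-- Branch on the register. -/
def switchW (f : Option Bool → WordProg I) : WordProg I := .switch fun r => f r.2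

/-- Loop while the register satisfies `c`. -/
def loopW (c : Option Bool → Bool) (p : WordProg I) : WordProg I := .loop (fun r => c r.2) p

namespace RunW

variable {p q : WordProg I} {o o' o'' : Option Bool} {w w' w'' : Work → List Bool} {m n : ℕ}

theorem mono (h : RunW p o w m o' w') (hmn : m ≤ n) : RunW p o w n o' w' :=
  fun v i => (h v i).mono hmn

theorem cast (h : RunW p o w n o' w') (hw : w' = w'') : RunW p o w n o' w'' := hw ▸ h

theorem seq (h₁ : RunW p o w m o' w') (h₂ : RunW q o' w' n o'' w'') :
    RunW (p.seq q) o w (m + n) o'' w'' :=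
  fun v i => (h₁ v i).seq (h₂ v i)

theorem popW (k : Work) (o : Option Bool) (w : Work → List Bool) :
    RunW (I := I) (popW k) o w 1 (w k).head? (Function.update w k (w k).tail) := fun v i => by
  rw [← update_allStacks_work]
  exact (Prog.Run.pop (Γ := StackSymbol I) (.work k) _ _ _).le

theorem pushW (k : Work) (f : Option Bool → Bool) (o : Option Bool) (w : Work → List Bool) :
    RunW (I := I) (pushW k f) o w 1 o (Function.update w k (f o :: w k)) := fun v i => by
  rw [← update_allStacks_work]
  exact (Prog.Run.push (Γ := StackSymbol I) (.work k) _ _ _).le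

theorem loadW (o' o : Option Bool) (w : Work → List Bool) :
    RunW (I := I) (loadW o') o w 1 o' w := fun _ _ =>
  (Prog.Run.load _ _ _).le

theorem switchW {f : Option Bool → WordProg I} (h : RunW (f o) o w n o' w') :
    RunW (switchW f) o w (n + 1) o' w' := fun v i =>
  Prog.RunLE.switch (s := ((v, o), allStacks i w)) (h v i)

theorem loop_done {c : Option Bool → Bool} (p : WordProg I) (w : Work → List Bool)
    (h : c o = false) : RunW (loopW c p) o w 1 o w := fun _ _ =>
  Prog.RunLE.loop_done _ h

theorem loop_step {c : Option Bool → Bool} (h : c o = true) (h₁ : RunW p o w m o' w')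
    (h₂ : RunW (loopW c p) o' w' n o'' w'') : RunW (loopW c p) o w (m + n + 1) o'' w'' :=
  fun v i => Prog.RunLE.loop_step (s₁ := ((v, o), allStacks i w)) h (h₁ v i) (h₂ v i)

end RunW

/-- Transfer the contents of stack `k` onto stack `k'`. -/
def xfer (k k' : Work) : WordProg I :=
  (popW k).seq (loopW Option.isSome ((pushW k' fun o => o.getD false).seq (popW k)))

theorem RunW.xfer {k k' : Work} (hk : k ≠ k') (o : Option Bool) (w : Work → List Bool) :
    RunW (I := I) (xfer k k') o w (3 * (w k).length + 2) none
      (Function.update (Function.update w k' ((w k).reverse ++ w k')) k []) := by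
  -- The loop is always one pop ahead: `l` is the symbol in the register followed by stack `k`, and
  -- the register `none` of an empty `l` ends the loop.
  have key : ∀ (l : List Bool) (w : Work → List Bool), w k = l.tail →
      RunW (I := I) (loopW Option.isSome ((PolyTime.pushW k' fun o => o.getD false).seq
        (PolyTime.popW k))) l.head? w (3 * l.length + 1) none
        (Function.update (Function.update w k' (l.reverse ++ w k')) k []) := by
    intro l
    induction l with
    | nil =>
      intro w hw
      have : Function.update (Function.update w k' (([] : List Bool).reverse ++ w k')) k [] = w := by
        simpa using hw.symm
      rw [this]
      exact RunW.loop_done _ _ rfl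
    | cons x l ih =>
      intro w hw
      simp only [List.tail_cons] at hw
      have e₁ := (RunW.pushW (I := I) k' (fun o => o.getD false) (some x) w).seq
        (RunW.popW k (some x) _)
      simp only [Function.update_of_ne hk, hw, Option.getD_some] at e₁
      have e₂ := ih (Function.update (Function.update w k' (x :: w k')) k l.tail) (by simp)
      have := RunW.loop_step (c := Option.isSome) rfl e₁ e₂
      refine (RunW.mono (n := 3 * (x :: l).length + 1) this (by simp; omega)).cast ?_
      funext j
      by_cases h : j = k
      · subst h; simp
      · by_cases h' : j = k'
        · subst h'; simp [h]
        · simp [h, h']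
  have := (RunW.popW (I := I) k o w).seq (key (w k) _ (by simp))
  refine (this.mono (n := 3 * (w k).length + 2) (by omega)).cast ?_
  funext j
  by_cases h : j = k
  · subst h; simp
  · by_cases h' : j = k'
    · subst h'; simp [h]
    · simp [h, h']

/-- Move the tree on top of stack `a`, reversed, to stack `b`, using stack `c` as a counter. -/
def moveTree : WordProg I :=
  (loadW (some true)).seq (loopW Option.isSome
    ((popW .a).seq ((pushW .b fun o => o.getD false).seq
      ((switchW fun o => if o = some true then
          (pushW .c fun _ => true).seq (pushW .c fun _ => true) else loadW o).seq
        (popW .c)))))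

/-- Stack `c` counts in unary the trees still to be moved after the current one. A node bit pushes
two marks and a leaf bit none, and every round pops one. Popping from the empty `c` yields `none`,
which stops the loop exactly at the end of the tree. -/
theorem RunW.moveTree (t : Tree) (o : Option Bool) (r b d : List Bool) :
    RunW (I := I) moveTree o (work (t.ser ++ r) b [] d) (7 * t.size + 2) none
      (work r (t.ser.reverse ++ b) [] d) := by
  -- The loop does not stop between two subtrees, so the induction is in continuation form: given
  -- the run that starts after `t` has been moved, there is a run from before `t`, at the price of
  -- seven steps per symbol.
  have key : ∀ (t : Tree) (r b c : List Bool) (x : Bool) (n : ℕ) (w : Work → List Bool),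
      RunW (I := I) (loopW Option.isSome
        ((PolyTime.popW .a).seq ((PolyTime.pushW .b fun o => o.getD false).seq
          ((PolyTime.switchW fun o => if o = some true then
              (PolyTime.pushW .c fun _ => true).seq (PolyTime.pushW .c fun _ => true)
              else PolyTime.loadW o).seq (PolyTime.popW .c)))))
        c.head? (work r (t.ser.reverse ++ b) c.tail d) n none w →
      RunW (I := I) (loopW Option.isSome
        ((PolyTime.popW .a).seq ((PolyTime.pushW .b fun o => o.getD false).seq
          ((PolyTime.switchW fun o => if o = some true then
              (PolyTime.pushW .c fun _ => true).seq (PolyTime.pushW .c fun _ => true)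
              else PolyTime.loadW o).seq (PolyTime.popW .c)))))
        (some x) (work (t.ser ++ r) b c d) (n + 7 * t.size) none w := by
    intro t
    induction t with
    | nil =>
      intro r b c x n w h
      have e₁ := RunW.popW (I := I) .a (some x) (work (false :: r) b c d)
      have e₂ := RunW.pushW (I := I) .b (fun o => o.getD false) (some false) (work r b c d)
      have e₃ := RunW.loadW (I := I) (some false) (some false) (work r (false :: b) c d)
      have e₄ := RunW.popW (I := I) .c (some false) (work r (false :: b) c d)
      simp only [work_a, work_b, work_c, update_work_a, update_work_b, update_work_c,
        List.head?_cons, List.tail_cons, Option.getD_some] at e₁ e₂ e₃ e₄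
      exact (RunW.loop_step (c := Option.isSome) rfl (e₁.seq (e₂.seq ((RunW.switchW
        (by simpa using e₃)).seq e₄))) h).mono (by simp; omega)
    | node t₁ t₂ ih₁ ih₂ =>
      intro r b c x n w h
      have e₁ := RunW.popW (I := I) .a (some x) (work (true :: (t₁.ser ++ (t₂.ser ++ r))) b c d)
      have e₂ := RunW.pushW (I := I) .b (fun o => o.getD false) (some true)
        (work (t₁.ser ++ (t₂.ser ++ r)) b c d)
      have e₃ := RunW.pushW (I := I) .c (fun _ => true) (some true)
        (work (t₁.ser ++ (t₂.ser ++ r)) (true :: b) c d)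
      have e₃' := RunW.pushW (I := I) .c (fun _ => true) (some true)
        (work (t₁.ser ++ (t₂.ser ++ r)) (true :: b) (true :: c) d)
      have e₄ := RunW.popW (I := I) .c (some true)
        (work (t₁.ser ++ (t₂.ser ++ r)) (true :: b) (true :: true :: c) d)
      simp only [work_a, work_b, work_c, update_work_a, update_work_b, update_work_c,
        List.head?_cons, List.tail_cons, Option.getD_some] at e₁ e₂ e₃ e₃' e₄
      have h₂ := ih₂ r (t₁.ser.reverse ++ true :: b) c true n w (by simpa [Tree.ser] using h)
      have h₁ := ih₁ (t₂.ser ++ r) (true :: b) (true :: c) true _ w h₂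
      have := RunW.loop_step (c := Option.isSome) (o := some x) rfl (e₁.seq (e₂.seq
        ((RunW.switchW (by simpa using e₃.seq e₃')).seq e₄))) h₁
      simpa [Tree.ser] using this.mono (n := n + 7 * (t₁.node t₂).size) (by simp; omega)
  have := (RunW.loadW (I := I) (some true) o (work (t.ser ++ r) b [] d)).seq
    (key t r b [] true 1 _ (RunW.loop_done _ _ rfl))
  exact this.mono (by omega)

/-- Empty stack `b` onto stacks `a` and `d`. -/
def distribute : WordProg I :=
  (popW .b).seq (loopW Option.isSome ((pushW .a fun o => o.getD false).seq
    ((pushW .d fun o => o.getD false).seq (popW .b))))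

theorem RunW.distribute (o : Option Bool) (a b c d : List Bool) :
    RunW (I := I) distribute o (work a b c d) (4 * b.length + 2) none
      (work (b.reverse ++ a) [] c (b.reverse ++ d)) := by
  have key : ∀ (l a d : List Bool),
      RunW (I := I) (loopW Option.isSome ((PolyTime.pushW .a fun o => o.getD false).seq
        ((PolyTime.pushW .d fun o => o.getD false).seq (PolyTime.popW .b)))) l.head?
        (work a l.tail c d) (4 * l.length + 1) none
        (work (l.reverse ++ a) [] c (l.reverse ++ d)) := by
    intro l
    induction l with
    | nil => exact fun a d => RunW.loop_done _ _ rfl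
    | cons x l ih =>
      intro a d
      have e₁ := RunW.pushW (I := I) .a (fun o => o.getD false) (some x) (work a l c d)
      have e₂ := RunW.pushW (I := I) .d (fun o => o.getD false) (some x) (work (x :: a) l c d)
      have e₃ := RunW.popW (I := I) .b (some x) (work (x :: a) l c (x :: d))
      simp only [work_a, work_b, work_d, update_work_a, update_work_b, update_work_d,
        Option.getD_some] at e₁ e₂ e₃
      have := (RunW.loop_step (c := Option.isSome) (o := some x) rfl (e₁.seq (e₂.seq e₃))
        (ih (x :: a) (x :: d))).mono (n := 4 * (x :: l).length + 1) (by simp; omega)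
      simpa using this
  have := RunW.popW (I := I) .b o (work a b c d)
  simp only [work_b, update_work_b] at this
  exact (this.seq (key b a d)).mono (by omega)

/-- Empty stack `b`. -/
def clear : WordProg I := (popW .b).seq (loopW Option.isSome (popW .b))

theorem RunW.clear (o : Option Bool) (a b c d : List Bool) :
    RunW (I := I) clear o (work a b c d) (2 * b.length + 2) none (work a [] c d) := by
  have key : ∀ l : List Bool, RunW (I := I) (loopW Option.isSome (PolyTime.popW .b)) l.head?
        (work a l.tail c d) (2 * l.length + 1) none (work a [] c d) := by
    intro l
    induction l with
    | nil => exact RunW.loop_done _ _ rfl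
    | cons x l ih =>
      have e := RunW.popW (I := I) .b (some x) (work a l c d)
      simp only [work_b, update_work_b] at e
      exact (RunW.loop_step (c := Option.isSome) (o := some x) rfl e ih).mono (by simp; omega)
  have := RunW.popW (I := I) .b o (work a b c d)
  simp only [work_b, update_work_b] at this
  exact (this.seq (key b)).mono (by omega)

/-! ### Programs acting on the trees on top of stack `a` -/

/-- `RunA p r n r'`: started with `r` on stack `a` and all other work stacks empty, `p` terminates
after at most `n` steps with `r'` on stack `a` and all other work stacks empty. -/
def RunA (p : WordProg I) (r : List Bool) (n : ℕ) (r' : List Bool) : Prop :=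
  ∀ o, ∃ o', RunW p o (work r [] [] []) n o' (work r' [] [] [])

namespace RunA

variable {p q : WordProg I} {r r' r'' : List Bool} {m n : ℕ}

theorem mono (h : RunA p r m r') (hmn : m ≤ n) : RunA p r n r' := fun o => by
  obtain ⟨o', h⟩ := h o
  exact ⟨o', h.mono hmn⟩

theorem seq (h₁ : RunA p r m r') (h₂ : RunA q r' n r'') : RunA (p.seq q) r (m + n) r'' :=
  fun o => by
    obtain ⟨o', h₁⟩ := h₁ o
    obtain ⟨o'', h₂⟩ := h₂ o'
    exact ⟨o'', h₁.seq h₂⟩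

theorem pushW (b : Bool) (r : List Bool) :
    RunA (I := I) (pushW .a fun _ => b) r 1 (b :: r) := fun o => by
  have := RunW.pushW (I := I) .a (fun _ => b) o (work r [] [] [])
  exact ⟨o, by simpa using this⟩

theorem skip (r : List Bool) : RunA (I := I) (loadW none) r 1 r := fun o =>
  ⟨none, RunW.loadW none o _⟩

theorem popW (b : Bool) (r : List Bool) : RunA (I := I) (popW .a) (b :: r) 1 r := fun o => by
  have := RunW.popW (I := I) .a o (work (b :: r) [] [] [])
  exact ⟨some b, by simpa using this⟩

end RunA

/-- Duplicate the tree on top of stack `a`. -/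
def dup : WordProg I := moveTree.seq (distribute.seq ((xfer .d .c).seq (xfer .c .a)))

/-- Reading the reversed code back from `b` restores its order on `a` and on `d` alike. The copy on
`d` is then reversed twice, on its way through `c`, to arrive on `a` in the right order. -/
theorem RunA.dup (t : Tree) (r : List Bool) :
    RunA (I := I) dup (t.ser ++ r) (17 * t.size + 8) (t.ser ++ (t.ser ++ r)) := fun o => by
  have e₁ := RunW.moveTree (I := I) t o r [] []
  have e₂ := RunW.distribute (I := I) none r t.ser.reverse [] []
  have e₃ := RunW.xfer (I := I) (k := .d) (k' := .c) (by simp) none (work (t.ser ++ r) [] [] t.ser)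
  have e₄ := RunW.xfer (I := I) (k := .c) (k' := .a) (by simp) none
    (work (t.ser ++ r) [] t.ser.reverse [])
  simp only [work_a, work_c, work_d, update_work_a, update_work_c, update_work_d, List.append_nil,
    List.reverse_reverse, List.length_reverse, Tree.length_ser] at e₁ e₂ e₃ e₄
  exact ⟨none, (e₁.seq (e₂.seq (e₃.seq e₄))).mono (by omega)⟩

/-- Remove the tree on top of stack `a`. -/
def drop : WordProg I := moveTree.seq clear

theorem RunA.drop (t : Tree) (r : List Bool) :
    RunA (I := I) drop (t.ser ++ r) (9 * t.size + 4) r := fun o => by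
  have e₁ := RunW.moveTree (I := I) t o r [] []
  have e₂ := RunW.clear (I := I) none r t.ser.reverse [] []
  simp only [List.append_nil, List.length_reverse, Tree.length_ser] at e₁ e₂
  exact ⟨none, (e₁.seq e₂).mono (by omega)⟩

/-- Exchange the two topmost trees on stack `a`. -/
def swap : WordProg I :=
  moveTree.seq ((xfer .b .d).seq (moveTree.seq ((xfer .d .c).seq ((xfer .c .a).seq (xfer .b .a)))))

/-- The first tree is parked on `d`: `c` must be empty for the counter of `moveTree`, and on `b` it
would lie below the second tree and return in the old order. The detour through `c` only corrects
the orientation. -/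
theorem RunA.swap (t u : Tree) (r : List Bool) :
    RunA (I := I) swap (t.ser ++ (u.ser ++ r)) (16 * t.size + 10 * u.size + 12)
      (u.ser ++ (t.ser ++ r)) := fun o => by
  have e₁ := RunW.moveTree (I := I) t o (u.ser ++ r) [] []
  have e₂ := RunW.xfer (I := I) (k := .b) (k' := .d) (by simp) none
    (work (u.ser ++ r) t.ser.reverse [] [])
  have e₃ := RunW.moveTree (I := I) u none r [] t.ser
  have e₄ := RunW.xfer (I := I) (k := .d) (k' := .c) (by simp) none
    (work r u.ser.reverse [] t.ser)
  have e₅ := RunW.xfer (I := I) (k := .c) (k' := .a) (by simp) none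
    (work r u.ser.reverse t.ser.reverse [])
  have e₆ := RunW.xfer (I := I) (k := .b) (k' := .a) (by simp) none
    (work (t.ser ++ r) u.ser.reverse [] [])
  simp only [work_a, work_b, work_c, work_d, update_work_a, update_work_b, update_work_c,
    update_work_d, List.append_nil, List.reverse_reverse, List.length_reverse,
    Tree.length_ser] at e₁ e₂ e₃ e₄ e₅ e₆
  exact ⟨none, (e₁.seq (e₂.seq (e₃.seq (e₄.seq (e₅.seq e₆))))).mono (by omega)⟩

/-- Pop a bit from stack `a` and branch on it. -/
def branch (p q : WordProg I) : WordProg I :=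
  (popW .a).seq (switchW fun o => if o = some true then p else q)

theorem RunA.branch_true {p : WordProg I} {r r' : List Bool} {n : ℕ} (h : RunA p r n r')
    (q : WordProg I) : RunA (branch p q) (true :: r) (n + 2) r' := fun o => by
  have e := RunW.popW (I := I) .a o (work (true :: r) [] [] [])
  obtain ⟨o', h⟩ := h (some true)
  simp only [work_a, update_work_a, List.head?_cons, List.tail_cons] at e
  exact ⟨o', (e.seq (RunW.switchW (by simpa using h))).mono (by omega)⟩

theorem RunA.branch_false {q : WordProg I} {r r' : List Bool} {n : ℕ} (h : RunA q r n r')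
    (p : WordProg I) : RunA (branch p q) (false :: r) (n + 2) r' := fun o => by
  have e := RunW.popW (I := I) .a o (work (false :: r) [] [] [])
  obtain ⟨o', h⟩ := h (some false)
  simp only [work_a, update_work_a, List.head?_cons, List.tail_cons] at e
  exact ⟨o', (e.seq (RunW.switchW (by simpa using h))).mono (by omega)⟩

/-- Pop a bit from stack `a`; as long as it is `true`, execute `p` and pop the next bit. -/
def popLoop (p : WordProg I) : WordProg I :=
  (popW .a).seq (loopW (fun o => o = some true) (p.seq (popW .a)))

/-- The behaviour of `popLoop p` after the first bit has been popped. -/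
def LoopA (p : WordProg I) (r : List Bool) (n : ℕ) (r' : List Bool) : Prop :=
  ∃ o', RunW (loopW (fun o => o = some true) (p.seq (popW .a))) r.head?
    (work r.tail [] [] []) n o' (work r' [] [] [])

theorem LoopA.done (p : WordProg I) (r : List Bool) : LoopA p (false :: r) 1 r :=
  ⟨_, RunW.loop_done _ _ (by simp)⟩

theorem LoopA.step {p : WordProg I} {r r' r'' : List Bool} {m n : ℕ} (h : RunA p r m r')
    (h' : LoopA p r' n r'') : LoopA p (true :: r) (m + n + 2) r'' := by
  obtain ⟨o₁, h⟩ := h (some true)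
  obtain ⟨o₂, h'⟩ := h'
  have e := RunW.popW (I := I) .a o₁ (work r' [] [] [])
  simp only [work_a, update_work_a] at e
  exact ⟨o₂, (RunW.loop_step (by simp) (h.seq e) h').mono (by omega)⟩

theorem LoopA.mono {p : WordProg I} {r r' : List Bool} {m n : ℕ} (h : LoopA p r m r')
    (hmn : m ≤ n) : LoopA p r n r' := by
  obtain ⟨o, h⟩ := h
  exact ⟨o, h.mono hmn⟩

theorem RunA.popLoop {p : WordProg I} {r r' : List Bool} {n : ℕ} (h : LoopA p r n r') :
    RunA (popLoop p) r (n + 1) r' := fun o => by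
  obtain ⟨o', h⟩ := h
  have e := RunW.popW (I := I) .a o (work r [] [] [])
  simp only [work_a, update_work_a] at e
  exact ⟨o', (e.seq h).mono (by omega)⟩

end PolyTime

/-! ### Functions that are computable in polynomial time on tree encodings -/

namespace PolyTime

variable {α β γ δ : Type}

/-- An encoding of the elements of a type by trees. -/
class TreeEnc (α : Type) where
  tree : α → Tree

open TreeEnc

instance : TreeEnc Tree := ⟨id⟩

instance : TreeEnc Unit := ⟨fun _ => .nil⟩

instance : TreeEnc Bool := ⟨fun b => if b then .node .nil .nil else .nil⟩

instance [TreeEnc α] [TreeEnc β] : TreeEnc (α × β) := ⟨fun x => .node (tree x.1) (tree x.2)⟩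

/-- A nonempty list has the tree of the pair of its head and tail, and an option that of a list with
at most one element. Constructors and case distinctions therefore need no recoding. -/
instance [TreeEnc α] : TreeEnc (List α) := ⟨List.foldr (fun a t => .node (tree a) t) .nil⟩

instance [TreeEnc α] : TreeEnc (Option α) := ⟨fun o => tree o.toList⟩

theorem tree_true : tree true = .node .nil .nil := rfl

theorem tree_false : tree false = .nil := rfl

theorem tree_pair [TreeEnc α] [TreeEnc β] (a : α) (b : β) :
    tree (a, b) = .node (tree a) (tree b) := rfl

theorem tree_nil [TreeEnc α] : tree ([] : List α) = .nil := rfl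

theorem tree_cons [TreeEnc α] (a : α) (l : List α) :
    tree (a :: l) = .node (tree a) (tree l) := rfl

theorem tree_some [TreeEnc α] (a : α) : tree (some a) = .node (tree a) .nil := rfl

/-- The size of an encoded element. -/
def sz [TreeEnc α] (a : α) : ℕ := (tree a).size

theorem sz_pos [TreeEnc α] (a : α) : 0 < sz a := Tree.size_pos _

theorem sz_bool_le (b : Bool) : sz b ≤ 3 := by cases b <;> simp [sz, tree_true, tree_false]

theorem le_sz_bool (b : Bool) : 1 ≤ sz b := sz_pos b

@[simp] theorem sz_true : sz true = 3 := rfl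

@[simp] theorem sz_false : sz false = 1 := rfl

@[simp] theorem sz_pair [TreeEnc α] [TreeEnc β] (a : α) (b : β) :
    sz (a, b) = sz a + sz b + 1 := by simp [sz, tree_pair]

@[simp] theorem sz_nil [TreeEnc α] : sz ([] : List α) = 1 := rfl

@[simp] theorem sz_cons [TreeEnc α] (a : α) (l : List α) : sz (a :: l) = sz a + sz l + 1 := by
  simp [sz, tree_cons]

@[simp] theorem sz_none [TreeEnc α] : sz (none : Option α) = 1 := rfl

@[simp] theorem sz_some [TreeEnc α] (a : α) : sz (some a) = sz a + 2 := by
  simp [sz, tree_some]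

theorem length_lt_sz [TreeEnc α] (l : List α) : l.length < sz l := by
  induction l with
  | nil => simp
  | cons a l ih => simp; omega

theorem sz_append [TreeEnc α] (l l' : List α) : sz (l ++ l') + 1 = sz l + sz l' := by
  induction l with
  | nil => simp; omega
  | cons a l ih => simp; omega

theorem sz_reverse [TreeEnc α] (l : List α) : sz l.reverse = sz l := by
  induction l with
  | nil => simp
  | cons a l ih =>
    have := sz_append l.reverse [a]
    simp at this ⊢; omega

theorem sz_boolList_le (l : List Bool) : sz l ≤ 4 * l.length + 1 := by
  induction l with
  | nil => simp
  | cons b l ih => have := sz_bool_le b; simp; omega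

/-- Coefficients in `ℕ` are nonnegative. Monotonicity is what allows time bounds to be composed. -/
theorem eval_mono (P : Polynomial ℕ) {m n : ℕ} (h : m ≤ n) : P.eval m ≤ P.eval n := by
  induction P using Polynomial.induction_on' with
  | add p q hp hq => simpa using add_le_add hp hq
  | monomial k a =>
    simp only [Polynomial.eval_monomial]
    gcongr

/-- Case distinction on a list. -/
def lcase (l : List β) (n : γ) (c : β → List β → γ) : γ :=
  match l with
  | [] => n
  | b :: t => c b t

@[simp] theorem lcase_nil (n : γ) (c : β → List β → γ) : lcase [] n c = n := rfl

@[simp] theorem lcase_cons (b : β) (t : List β) (n : γ) (c : β → List β → γ) :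
    lcase (b :: t) n c = c b t := rfl

/-- Case distinction on an option. -/
def ocase (o : Option β) (n : γ) (c : β → γ) : γ :=
  match o with
  | none => n
  | some b => c b

@[simp] theorem ocase_none (n : γ) (c : β → γ) : ocase none n c = n := rfl

@[simp] theorem ocase_some (b : β) (n : γ) (c : β → γ) : ocase (some b) n c = c b := rfl

/-! ### The class of polynomial-time functions and its basic closure properties -/

variable [TreeEnc α] [TreeEnc β] [TreeEnc γ] [TreeEnc δ]

/-- Functions that are computable in polynomial time: some program replaces an encoded argument on
top of the stack by the encoded value. -/
@[fun_prop]
def Poly (f : α → β) : Prop :=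
  ∃ (p : ∀ I, WordProg I) (T : Polynomial ℕ), ∀ x,
    (∀ I r, RunA (p I) ((tree x).ser ++ r) (T.eval (sz x)) ((tree (f x)).ser ++ r)) ∧
    sz (f x) ≤ T.eval (sz x)

namespace Poly

/-- The word on the stack stays the same, so a program without effect on the stacks suffices.
Constructors enter `Poly` in this way. -/
theorem of_tree_eq {f : α → β} (h : ∀ a, tree (f a) = tree a) : Poly f :=
  ⟨fun _ => loadW none, .X + 1, fun x =>
    ⟨fun I r => by rw [h]; exact (RunA.skip _).mono (by simp), by simp [sz, h]⟩⟩

@[fun_prop]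
theorem id : Poly (fun a : α => a) := of_tree_eq fun _ => rfl

@[fun_prop]
-- The size bound in `Poly` is needed here: the second program runs in time polynomial in the size
-- of the intermediate value.
theorem comp {g : β → γ} {f : α → β} (hg : Poly g) (hf : Poly f) : Poly (fun a => g (f a)) := by
  obtain ⟨p, T, hf⟩ := hf
  obtain ⟨q, U, hg⟩ := hg
  refine ⟨fun I => (p I).seq (q I), T + U.comp T, fun x => ⟨fun I r => ?_, ?_⟩⟩
  · refine (((hf x).1 I r).seq ((hg (f x)).1 I r)).mono ?_
    have := eval_mono U (hf x).2
    simp only [Polynomial.eval_add, Polynomial.eval_comp]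
    omega
  · have := eval_mono U (hf x).2
    have := (hg (f x)).2
    simp only [Polynomial.eval_add, Polynomial.eval_comp]
    omega

/-- Push a word onto stack `a`. -/
def _root_.PolyTime.pushList {I : Type} : List Bool → WordProg I
  | [] => loadW none
  | b :: l => (pushList l).seq (pushW .a fun _ => b)

theorem _root_.PolyTime.RunA.pushList {I : Type} (l r : List Bool) :
    RunA (I := I) (pushList l) r (l.length + 1) (l ++ r) := by
  induction l with
  | nil => exact RunA.skip r
  | cons b l ih => exact ih.seq (RunA.pushW b _)

@[fun_prop]
theorem const (c : β) : Poly (fun _ : α => c) :=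
  ⟨fun _ => drop.seq (pushList (tree c).ser), 9 * .X + .C (sz c + 5), fun x =>
    ⟨fun I r => ((RunA.drop _ _).seq (RunA.pushList _ _)).mono (by
      simp [sz]; omega), by simp; omega⟩⟩

@[fun_prop]
-- In prefix notation, `true` in front of two adjacent codes makes the code of the pair. The value
-- of `g` is computed first, on a copy of the argument, and exchanged with the argument so that the
-- value of `f` ends up above it.
theorem mk {f : α → β} {g : α → γ} (hf : Poly f) (hg : Poly g) : Poly (fun a => (f a, g a)) := by
  obtain ⟨p, T, hf⟩ := hf
  obtain ⟨q, U, hg⟩ := hg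
  refine ⟨fun I => dup.seq ((q I).seq (swap.seq ((p I).seq (pushW .a fun _ => true)))),
    34 * .X + 27 * (T + U) + 30, fun x => ⟨fun I r => ?_, ?_⟩⟩
  · have e₁ := RunA.dup (I := I) (tree x) r
    have e₂ := (hg x).1 I ((tree x).ser ++ r)
    have e₃ := RunA.swap (I := I) (tree (g x)) (tree x) r
    have e₄ := (hf x).1 I ((tree (g x)).ser ++ r)
    have e₅ := RunA.pushW (I := I) true ((tree (f x)).ser ++ ((tree (g x)).ser ++ r))
    have e := (e₁.seq (e₂.seq (e₃.seq (e₄.seq e₅)))).mono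
      (n := (34 * .X + 27 * (T + U) + 30 : Polynomial ℕ).eval (sz x)) (by
        have := (hg x).2
        simp [sz] at this ⊢
        omega)
    simpa [tree_pair, Tree.ser] using e
  · have := (hf x).2
    have := (hg x).2
    simp
    omega

theorem fst' : Poly (Prod.fst : α × β → α) :=
  ⟨fun _ => (popW .a).seq (swap.seq drop), 35 * .X + 20, fun ⟨a, b⟩ => ⟨fun I r => by
    have e₁ := RunA.popW (I := I) true ((tree a).ser ++ ((tree b).ser ++ r))
    have e₂ := RunA.swap (I := I) (tree a) (tree b) r
    have e₃ := RunA.drop (I := I) (tree b) ((tree a).ser ++ r)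
    have e := (e₁.seq (e₂.seq e₃)).mono (n := (35 * .X + 20 : Polynomial ℕ).eval (sz (a, b))) (by
      simp
      simp only [sz]
      omega)
    simpa [tree_pair, Tree.ser] using e, by
      simp
      omega⟩⟩

theorem snd' : Poly (Prod.snd : α × β → β) :=
  ⟨fun _ => (popW .a).seq drop, 35 * .X + 20, fun ⟨a, b⟩ => ⟨fun I r => by
    have e₁ := RunA.popW (I := I) true ((tree a).ser ++ ((tree b).ser ++ r))
    have e₂ := RunA.drop (I := I) (tree a) ((tree b).ser ++ r)
    have e := (e₁.seq e₂).mono (n := (35 * .X + 20 : Polynomial ℕ).eval (sz (a, b))) (by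
      simp
      simp only [sz]
      omega)
    simpa [tree_pair, Tree.ser] using e, by
      simp
      omega⟩⟩

@[fun_prop]
theorem fst {f : α → β × γ} (hf : Poly f) : Poly (fun a => (f a).1) := fst'.comp hf

@[fun_prop]
theorem snd {f : α → β × γ} (hf : Poly f) : Poly (fun a => (f a).2) := snd'.comp hf

@[fun_prop]
theorem cons {f : α → β} {g : α → List β} (hf : Poly f) (hg : Poly g) :
    Poly (fun a => f a :: g a) :=
  (of_tree_eq (f := fun x : β × List β => x.1 :: x.2) fun _ => rfl).comp (hf.mk hg)

/-- Case distinction between the empty tree and the other ones. -/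
theorem case_of {h : α → δ} {n : α → γ} {c : α × β → γ} {f : α → γ} (hh : Poly h) (hn : Poly n)
    (hc : Poly c) (H : ∀ a, (tree (h a) = .nil ∧ f a = n a) ∨
      ∃ b, tree (h a) = tree b ∧ tree b ≠ .nil ∧ f a = c (a, b)) : Poly f := by
  obtain ⟨p, T, hh⟩ := hh
  obtain ⟨q, U, hn⟩ := hn
  obtain ⟨s, V, hc⟩ := hc
  -- The branch consumes the first bit of the code of `h x`. For the empty tree this is the whole
  -- code; otherwise the bit is pushed back, and after the swap a further `true` joins `x` and `b`
  -- into a pair.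
  refine ⟨fun I => dup.seq ((p I).seq (branch ((pushW .a fun _ => true).seq
    (swap.seq ((pushW .a fun _ => true).seq (s I)))) (q I))),
    T + U + V.comp (.X + T + 1) + 27 * .X + 16 * T + 30, fun x => ?_⟩
  have e₁ : ∀ I r, RunA (I := I) dup _ _ _ := fun I r => RunA.dup (tree x) r
  obtain ⟨h₁, h₁'⟩ := hh x
  rcases H x with ⟨hx, hf⟩ | ⟨b, hx, hb, hf⟩
  · rw [hf]
    obtain ⟨h₂, h₂'⟩ := hn x
    refine ⟨fun I r => ?_, by simp; omega⟩
    have e₂ := h₁ I ((tree x).ser ++ r)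
    rw [hx] at e₂
    refine ((e₁ I r).seq (e₂.seq (RunA.branch_false (h₂ I r) _))).mono ?_
    simp [sz]
    omega
  · rw [hf]
    obtain ⟨h₂, h₂'⟩ := hc (x, b)
    have hle : sz b ≤ T.eval (sz x) := by
      unfold sz at h₁' ⊢
      rwa [← hx]
    have hV : V.eval (sz (x, b)) ≤ V.eval (sz x + T.eval (sz x) + 1) :=
      eval_mono V (by simp; omega)
    refine ⟨fun I r => ?_, by simp at h₂' hV ⊢; omega⟩
    have e₂ := h₁ I ((tree x).ser ++ r)
    cases hb' : tree b with
    | nil => exact absurd hb' hb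
    | node t u =>
      have e₃ := RunA.pushW (I := I) true (t.ser ++ (u.ser ++ ((tree x).ser ++ r)))
      have e₄ := RunA.swap (I := I) (tree b) (tree x) r
      have e₅ := RunA.pushW (I := I) true ((tree x).ser ++ ((tree b).ser ++ r))
      have e₆ := h₂ I r
      have hser : (tree b).ser ++ ((tree x).ser ++ r) =
        true :: (t.ser ++ (u.ser ++ ((tree x).ser ++ r))) := by simp [hb', Tree.ser]
      rw [hx, hser] at e₂
      rw [← hser] at e₃
      have hser' : (tree (x, b)).ser ++ r = true :: ((tree x).ser ++ ((tree b).ser ++ r)) := by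
        simp [tree_pair, Tree.ser]
      rw [hser'] at e₆
      refine ((e₁ I _).seq (e₂.seq (RunA.branch_true (e₃.seq (e₄.seq (e₅.seq e₆))) _))).mono ?_
      simp at hV ⊢
      unfold sz at *
      omega

@[fun_prop]
theorem cond {c : α → Bool} {f g : α → β} (hc : Poly c) (hf : Poly f) (hg : Poly g) :
    Poly (fun a => bif c a then f a else g a) :=
  case_of (β := Bool) hc hg (hf.comp fst') fun a => by
    cases h : c a
    · exact .inl ⟨rfl, rfl⟩
    · exact .inr ⟨true, rfl, by simp [tree_true], rfl⟩

end Poly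

namespace Poly

@[fun_prop]
theorem lcase {l : α → List β} {n : α → γ} {c : α → β → List β → γ} (hl : Poly l) (hn : Poly n)
    (hc : Poly fun x : α × β × List β => c x.1 x.2.1 x.2.2) :
    Poly fun a => lcase (l a) (n a) (c a) :=
  case_of hl hn hc fun a => by
    rcases h : l a with _ | ⟨b, t⟩
    · exact .inl ⟨rfl, rfl⟩
    · exact .inr ⟨(b, t), rfl, by simp [tree_pair], rfl⟩

@[fun_prop]
theorem ocase {o : α → Option β} {n : α → γ} {c : α → β → γ} (ho : Poly o) (hn : Poly n)
    (hc : Poly fun x : α × β => c x.1 x.2) :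
    Poly fun a => ocase (o a) (n a) (c a) :=
  -- `some b` and `(b, ())` have the same tree.
  case_of (β := β × Unit) (c := fun x => c x.1 x.2.1) ho hn
    (hc.comp (fst'.mk (fst'.comp snd'))) fun a => by
    rcases h : o a with _ | b
    · exact .inl ⟨rfl, rfl⟩
    · exact .inr ⟨(b, ()), rfl, by simp [tree_pair], rfl⟩

@[fun_prop]
theorem some {f : α → β} (hf : Poly f) : Poly fun a => some (f a) :=
  (of_tree_eq (f := fun x : β × Unit => Option.some x.1) fun _ => rfl).comp (hf.mk (const ()))

/-- A polynomial bound on a single step would not do, since iterating it may give exponential size.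
By `hq` a step adds to the accumulator an amount that does not depend on the accumulator, so all
intermediate sizes stay below the initial size plus the length of the list times a fixed amount. -/
theorem foldl {l : α → List β} {d : α → δ} {s : α → δ → β → δ} (hl : Poly l) (hd : Poly d)
    (hs : Poly fun x : α × δ × β => s x.1 x.2.1 x.2.2) (q : Polynomial ℕ)
    (hq : ∀ a d b, sz (s a d b) ≤ sz d + q.eval (sz (a, b))) :
    Poly fun a => (l a).foldl (s a) (d a) := by
  have hinit : Poly fun a => (l a, (a, d a)) := by fun_prop
  have hg : Poly fun x : (β × List β) × (α × δ) => (x.1.2, (x.2.1, s x.2.1 x.2.2 x.1.1)) := by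
    have : Poly fun x : (β × List β) × (α × δ) => s x.2.1 x.2.2 x.1.1 :=
      hs.comp (g := fun x : α × δ × β => s x.1 x.2.1 x.2.2)
        (f := fun x : (β × List β) × (α × δ) => (x.2.1, x.2.2, x.1.1)) (by fun_prop)
    fun_prop
  obtain ⟨p₀, T₀, h₀⟩ := hinit
  obtain ⟨p, T, h⟩ := hg
  obtain ⟨p₁, T₁, h₁⟩ := snd' (α := α) (β := δ)
  -- Between rounds the stack carries the code of the remaining list followed by that of `(a, d)`.
  -- `popLoop` reads the first bit of the list: `false` is the empty list and leaves `(a, d)`. After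
  -- `true`, two pushes build the code of `((b, l), (a, d))`; the final pop removes the outer node
  -- of the new pair.
  let body : ∀ I, WordProg I := fun I => (pushW .a fun _ => true).seq
    ((pushW .a fun _ => true).seq ((p I).seq (popW .a)))
  -- The left side of the bound by `B` is a potential: the accumulator gains at most `Q` in a round,
  -- and the shorter list releases that `Q`. Hence one `B` bounds the argument of `p` in all rounds.
  have key : ∀ (I : Type) (r : List Bool) (a : α) (Q B : ℕ) (l : List β) (d : δ),
      (∀ b ∈ l, ∀ d, sz (s a d b) ≤ sz d + Q) →
      sz l + sz a + sz d + l.length * Q + 5 ≤ B →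
      LoopA (body I) ((tree l).ser ++ ((tree (a, d)).ser ++ r)) (l.length * (T.eval B + 5) + 1)
        ((tree (a, l.foldl (s a) d)).ser ++ r) ∧ sz (l.foldl (s a) d) ≤ B := by
    intro I r a Q B l
    induction l with
    | nil =>
      intro d _ hB
      exact ⟨(LoopA.done _ _).mono (by simp), by simp at hB ⊢; omega⟩
    | cons b l ih =>
      intro d hQ hB
      have hd := hQ b (by simp) d
      obtain ⟨ih₁, ih₂⟩ := ih (s a d b) (fun b hb => hQ b (by simp [hb])) (by
        simp [Nat.add_mul] at hB ⊢
        omega)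
      refine ⟨?_, ih₂⟩
      have e₁ := RunA.pushW (I := I) true
        ((tree b).ser ++ ((tree l).ser ++ ((tree (a, d)).ser ++ r)))
      have e₂ := RunA.pushW (I := I) true
        (true :: ((tree b).ser ++ ((tree l).ser ++ ((tree (a, d)).ser ++ r))))
      have e₃ := (h ((b, l), (a, d))).1 I r
      have e₄ := RunA.popW (I := I) true ((tree l).ser ++ ((tree (a, s a d b)).ser ++ r))
      have hT : T.eval (sz ((b, l), (a, d))) ≤ T.eval B := eval_mono T (by
        simp at hB ⊢
        omega)
      simp only [tree_pair (b, l), tree_pair l, tree_pair b, Tree.ser, List.cons_append,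
        List.append_assoc] at e₃
      have := LoopA.step (e₁.seq (e₂.seq (e₃.seq e₄))) ih₁
      simp only [tree_cons, Tree.ser, List.cons_append, List.append_assoc, List.foldl_cons]
      refine this.mono ?_
      simp only [List.length_cons, Nat.add_mul]
      omega
  -- `T₀` bounds the initial state, hence also the length of the list and the size of each element;
  -- `N` thus bounds the initial potential.
  let N : Polynomial ℕ := T₀ + T₀ * q.comp (T₀ + .X + 1) + 5
  refine ⟨fun I => (p₀ I).seq ((popW .a).seq ((popLoop (body I)).seq (p₁ I))),
    T₀ + (T₀ * (T.comp N + 5) + 5) + T₁.comp (.X + N + 1) + N, fun x => ?_⟩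
  have hsz := (h₀ x).2
  simp only [sz_pair] at hsz
  have hlen := length_lt_sz (l x)
  have hN : sz (l x) + sz x + sz (d x) +
      (l x).length * q.eval (T₀.eval (sz x) + sz x + 1) + 5 ≤ N.eval (sz x) := by
    simp only [N, Polynomial.eval_add, Polynomial.eval_mul, Polynomial.eval_comp,
      Polynomial.eval_X, Polynomial.eval_one, Polynomial.eval_ofNat]
    have := Nat.mul_le_mul_right (q.eval (T₀.eval (sz x) + sz x + 1))
      (show (l x).length ≤ T₀.eval (sz x) by omega)
    omega
  have hQ : ∀ b ∈ l x, ∀ d, sz (s x d b) ≤ sz d + q.eval (T₀.eval (sz x) + sz x + 1) := by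
    intro b hb d
    have hb' : sz b ≤ sz (l x) := by
      obtain ⟨l₁, l₂, e⟩ := List.append_of_mem hb
      have := sz_append l₁ (b :: l₂)
      have := sz_pos l₁
      rw [e]
      simp at *
      omega
    have := eval_mono q (m := sz (x, b)) (n := T₀.eval (sz x) + sz x + 1) (by
      rw [sz_pair]
      omega)
    have := hq x d b
    omega
  refine ⟨fun I r => ?_, ?_⟩
  · obtain ⟨k₁, k₂⟩ := key I r x _ _ (l x) (d x) hQ hN
    have e₁ := (h₀ x).1 I r
    have e₂ := RunA.popW (I := I) true ((tree (l x)).ser ++ ((tree (x, d x)).ser ++ r))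
    simp only [tree_pair (l x), Tree.ser, List.cons_append, List.append_assoc] at e₁
    have e₄ := (h₁ (x, (l x).foldl (s x) (d x))).1 I r
    refine (e₁.seq (e₂.seq ((RunA.popLoop k₁).seq e₄))).mono ?_
    have hT₁ := eval_mono T₁ (m := sz (x, (l x).foldl (s x) (d x)))
      (n := sz x + N.eval (sz x) + 1) (by simp; omega)
    have := Nat.mul_le_mul_right (T.eval (N.eval (sz x)) + 5)
      (show (l x).length ≤ T₀.eval (sz x) by omega)
    simp only [Polynomial.eval_add, Polynomial.eval_mul, Polynomial.eval_comp,
      Polynomial.eval_X, Polynomial.eval_one, Polynomial.eval_ofNat]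
    omega
  -- The size estimate does not involve the input alphabet, so any type serves as `I`.
  · have := (key Unit [] x _ _ (l x) (d x) hQ hN).2
    simp only [Polynomial.eval_add]
    omega

end Poly

end PolyTime

/-! ### Polynomial-time list functions -/

namespace PolyTime

open TreeEnc

variable {α β γ δ : Type}

/-- The pointwise relation of lists of the same length. -/
def all₂ (r : β → γ → Bool) : List β → List γ → Bool
  | [], [] => true
  | b :: l, c :: m => r b c && all₂ r l m
  | _, _ => false

/-- The binary increment, least significant bit first. -/
def incr : List Bool → List Bool
  | [] => [true]
  | false :: l => true :: l
  | true :: l => false :: incr l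

/-- One step of the search for the element with binary index `k`. -/
def lookStep (k : List Bool) (d : List Bool × Option β) (b : β) : List Bool × Option β :=
  (incr d.1, bif all₂ BEq.beq k d.1 then some b else d.2)

/-- The element of a list with binary index `k`. -/
def look (k : List Bool) (l : List β) : Option β := (l.foldl (lookStep k) ([], none)).2

theorem all₂_iff {r : β → γ → Bool} {l : List β} {m : List γ} :
    all₂ r l m = true ↔ List.Forall₂ (fun b c => r b c = true) l m := by
  induction l generalizing m with
  | nil => cases m <;> simp [all₂]
  | cons b l ih => cases m <;> simp [all₂, ih]

theorem all₂_beq {l m : List Bool} : all₂ BEq.beq l m = true ↔ l = m := by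
  simp [all₂_iff]

theorem all₂_true {l : List β} {m : List γ} :
    all₂ (fun _ _ => true) l m = true ↔ l.length = m.length := by
  simp only [all₂_iff]
  constructor
  · exact List.Forall₂.length_eq
  · induction l generalizing m with
    | nil => cases m <;> simp
    | cons b l ih => cases m <;> simp; exact ih

theorem incr_encodeNat (n : ℕ) :
    incr (Computability.encodeNat n) = Computability.encodeNat (n + 1) := by
  have key : ∀ p : PosNum, incr (Computability.encodePosNum p) =
      Computability.encodePosNum p.succ := by
    intro p
    induction p with
    | one => rfl
    | bit0 p ih => rfl
    | bit1 p ih => simp [Computability.encodePosNum, incr, PosNum.succ, ih]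
  simp only [Computability.encodeNat, Nat.cast_add, Nat.cast_one, Num.add_one]
  cases (n : Num) with
  | zero => rfl
  | pos p => exact key p

theorem encodeNat_injective : Function.Injective Computability.encodeNat := fun m n h => by
  rw [← Computability.decode_encodeNat m, h, Computability.decode_encodeNat]

/-- The index is compared with the canonical codes produced by `incr`, so a non-canonical binary
numeral finds nothing. Rejecting words that are not encodings relies on this. -/
theorem look_eq_some {k : List Bool} {l : List β} {b : β} :
    look k l = some b ↔ ∃ i, k = Computability.encodeNat i ∧ l[i]? = some b := by
  -- Fold invariant: the counter is the code of the number of elements already passed.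
  have key : (l.foldl (lookStep k) ([], none)).1 = Computability.encodeNat l.length ∧
      ∀ b, (l.foldl (lookStep k) ([], none)).2 = some b ↔
        ∃ i, k = Computability.encodeNat i ∧ l[i]? = some b := by
    induction l using List.reverseRecOn with
    | nil => exact ⟨rfl, by simp⟩
    | append_singleton l x ih =>
      obtain ⟨ih₁, ih₂⟩ := ih
      rw [List.foldl_concat]
      refine ⟨by simp [lookStep, ih₁, incr_encodeNat], fun b => ?_⟩
      simp only [lookStep, ih₁]
      by_cases h : k = Computability.encodeNat l.length
      · rw [all₂_beq.2 h]
        subst h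
        constructor
        · intro h
          exact ⟨l.length, rfl, by simpa using h⟩
        · rintro ⟨i, hi, h⟩
          rw [← encodeNat_injective hi] at h
          simpa using h
      · rw [Bool.eq_false_iff.2 (mt all₂_beq.1 h), cond_false, ih₂]
        refine exists_congr fun i => and_congr_right fun hi => ?_
        have : i ≠ l.length := fun e => h (e ▸ hi)
        rcases lt_or_gt_of_ne this with h' | h'
        · rw [List.getElem?_append_left h']
        · rw [List.getElem?_eq_none (by omega), List.getElem?_eq_none (by simp; omega)]
  exact key.2 b

theorem look_encodeNat (i : ℕ) (l : List β) : look (Computability.encodeNat i) l = l[i]? := by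
  refine Option.ext fun b => ?_
  rw [look_eq_some]
  constructor
  · rintro ⟨j, hj, h⟩
    rwa [encodeNat_injective hj]
  · exact fun h => ⟨i, rfl, h⟩

variable [TreeEnc α] [TreeEnc β] [TreeEnc γ] [TreeEnc δ]

/-! ### Closure under Boolean and list operations -/

namespace Poly

theorem sz_le {f : α → β} (hf : Poly f) : ∃ T : Polynomial ℕ, ∀ a, sz (f a) ≤ T.eval (sz a) := by
  obtain ⟨p, T, h⟩ := hf
  exact ⟨T, fun a => (h a).2⟩

@[fun_prop]
theorem and {f g : α → Bool} (hf : Poly f) (hg : Poly g) : Poly fun a => f a && g a := by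
  have : Poly fun a => bif f a then g a else false := by fun_prop
  convert this using 2 with a
  cases f a <;> rfl

@[fun_prop]
theorem not {f : α → Bool} (hf : Poly f) : Poly fun a => !f a := by
  have : Poly fun a => bif f a then false else true := by fun_prop
  convert this using 2 with a
  cases f a <;> rfl

@[fun_prop]
theorem or {f g : α → Bool} (hf : Poly f) (hg : Poly g) : Poly fun a => f a || g a := by
  have : Poly fun a => bif f a then true else g a := by fun_prop
  convert this using 2 with a
  cases f a <;> rfl

@[fun_prop]
theorem beq {f g : α → Bool} (hf : Poly f) (hg : Poly g) : Poly fun a => f a == g a := by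
  have : Poly fun a => bif f a then g a else !g a := by fun_prop
  convert this using 2 with a
  cases f a <;> cases g a <;> rfl

@[fun_prop]
theorem reverse {l : α → List β} (hl : Poly l) : Poly fun a => (l a).reverse := by
  have : Poly fun a => (l a).foldl (fun d b => b :: d) [] :=
    foldl hl (const []) (by fun_prop) (.X + 1) fun a d b => by simp; omega
  simpa using this

theorem foldr {l : α → List β} {d : α → δ} {s : α → β → δ → δ} (hl : Poly l) (hd : Poly d)
    (hs : Poly fun x : α × β × δ => s x.1 x.2.1 x.2.2) (q : Polynomial ℕ)
    (hq : ∀ a b d, sz (s a b d) ≤ sz d + q.eval (sz (a, b))) :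
    Poly fun a => (l a).foldr (s a) (d a) := by
  have : Poly fun a => (l a).reverse.foldl (fun d b => s a b d) (d a) :=
    foldl hl.reverse hd (hs.comp (g := fun x : α × β × δ => s x.1 x.2.1 x.2.2)
      (f := fun x : α × δ × β => (x.1, x.2.2, x.2.1)) (by fun_prop)) q fun a d b => hq a b d
  simpa using this

@[fun_prop]
theorem map {l : α → List β} {f : α → β → γ} (hl : Poly l)
    (hf : Poly fun x : α × β => f x.1 x.2) : Poly fun a => (l a).map (f a) := by
  obtain ⟨T, hT⟩ := hf.sz_le
  have hf' : Poly fun x : α × β × List γ => f x.1 x.2.1 :=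
    hf.comp (g := fun x : α × β => f x.1 x.2) (f := fun x : α × β × List γ => (x.1, x.2.1))
      (by fun_prop)
  have : Poly fun a => (l a).foldr (fun b d => f a b :: d) [] :=
    foldr hl (const []) (by fun_prop) (T + 1) fun a b d => by
      have := hT (a, b)
      simp at this ⊢
      omega
  convert this using 2 with a
  exact List.map_eq_foldr

@[fun_prop]
theorem all {l : α → List β} {f : α → β → Bool} (hl : Poly l)
    (hf : Poly fun x : α × β => f x.1 x.2) : Poly fun a => (l a).all (f a) := by
  have hf' : Poly fun x : α × β × Bool => f x.1 x.2.1 :=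
    hf.comp (g := fun x : α × β => f x.1 x.2) (f := fun x : α × β × Bool => (x.1, x.2.1))
      (by fun_prop)
  have : Poly fun a => (l a).foldr (fun b d => f a b && d) true :=
    foldr hl (const true) (by fun_prop) 3 fun a b d => by
      have := sz_bool_le (f a b && d)
      simp only [Polynomial.eval_ofNat]
      omega
  convert this using 2 with a
  induction l a with
  | nil => rfl
  | cons b l ih => simp [ih]

@[fun_prop]
theorem any {l : α → List β} {f : α → β → Bool} (hl : Poly l)
    (hf : Poly fun x : α × β => f x.1 x.2) : Poly fun a => (l a).any (f a) := by
  have : Poly fun a => !(l a).all fun b => !f a b := by fun_prop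
  convert this using 2 with a
  induction l a with
  | nil => rfl
  | cons b l ih => simp [ih]

@[fun_prop]
theorem isEmpty {l : α → List β} (hl : Poly l) : Poly fun a => (l a).isEmpty := by
  have : Poly fun a => PolyTime.lcase (l a) true fun _ _ => false := by fun_prop
  convert this using 2 with a
  cases l a <;> rfl

@[fun_prop]
theorem all₂ {l : α → List β} {m : α → List γ} {r : α → β → γ → Bool} (hl : Poly l)
    (hm : Poly m) (hr : Poly fun x : α × β × γ => r x.1 x.2.1 x.2.2) :
    Poly fun a => all₂ (r a) (l a) (m a) := by
  have key : Poly fun a => (l a).foldl (fun (d : List γ × Bool) b =>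
      PolyTime.lcase d.1 ([], false) fun c m => (m, d.2 && r a b c)) (m a, true) := by
    have hr' : Poly fun x : (α × (List γ × Bool) × β) × γ × List γ => r x.1.1 x.1.2.2 x.2.1 :=
      hr.comp (g := fun x : α × β × γ => r x.1 x.2.1 x.2.2)
        (f := fun x : (α × (List γ × Bool) × β) × γ × List γ => (x.1.1, x.1.2.2, x.2.1))
        (by fun_prop)
    refine foldl hl (by fun_prop) (by fun_prop) 3 fun a d b => ?_
    obtain ⟨_ | ⟨c, m⟩, ok⟩ := d
    · simp
    · have := sz_bool_le (ok && r a b c)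
      have := le_sz_bool ok
      simp
      omega
  -- The fold over `l` consumes `m` alongside. If `m` is too short the flag becomes false; if it is
  -- too long, the final emptiness test fails.
  have h : ∀ a (l : List β) (m : List γ) (ok : Bool),
      let d := l.foldl (fun (d : List γ × Bool) b =>
        PolyTime.lcase d.1 ([], false) fun c m => (m, d.2 && r a b c)) (m, ok)
      (d.2 && d.1.isEmpty) = (ok && PolyTime.all₂ (r a) l m) := by
    intro a l
    induction l with
    | nil => intro m ok; cases m <;> simp [PolyTime.all₂]
    | cons b l ih =>
      intro m ok
      cases m with
      | nil => simpa [PolyTime.all₂] using ih [] false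
      | cons c m => simpa [PolyTime.all₂, Bool.and_assoc] using ih m (ok && r a b c)
  have := (snd key).and (fst key).isEmpty
  convert this using 2 with a
  simpa using (h a (l a) (m a) true).symm

@[fun_prop]
theorem zip {l : α → List β} {m : α → List γ} (hl : Poly l) (hm : Poly m) :
    Poly fun a => (l a).zip (m a) := by
  have key : Poly fun a => (l a).foldl (fun (d : List γ × List (β × γ)) b =>
      PolyTime.lcase d.1 ([], d.2) fun c m => (m, (b, c) :: d.2)) (m a, []) := by
    refine foldl hl (by fun_prop) (by fun_prop) (.X + 4) fun a d b => ?_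
    obtain ⟨_ | ⟨c, m⟩, acc⟩ := d
    · simp
    · simp
      omega
  have h : ∀ (l : List β) (m : List γ) (acc : List (β × γ)),
      (l.foldl (fun (d : List γ × List (β × γ)) b =>
        PolyTime.lcase d.1 ([], d.2) fun c m => (m, (b, c) :: d.2)) (m, acc)).2.reverse =
      acc.reverse ++ l.zip m := by
    intro l
    induction l with
    | nil => simp
    | cons b l ih =>
      intro m acc
      cases m with
      | nil => simpa using ih [] acc
      | cons c m => simpa using ih m ((b, c) :: acc)
  have := (snd key).reverse
  convert this using 2 with a
  simpa using (h (l a) (m a) []).symm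

@[fun_prop]
theorem incr {l : α → List Bool} (hl : Poly l) : Poly fun a => incr (l a) := by
  -- The Boolean is the carry, initially the one to be added. The digits are collected in reverse,
  -- and a carry left at the end becomes a new most significant digit.
  have key : Poly fun a => (l a).foldl (fun (d : Bool × List Bool) b =>
      (d.1 && b, (bif d.1 then !b else b) :: d.2)) (true, []) := by
    refine foldl hl (by fun_prop) (by fun_prop) 8 fun a d b => ?_
    have := sz_bool_le (d.1 && b)
    have := sz_bool_le (bif d.1 then !b else b)
    have := le_sz_bool d.1
    obtain ⟨c, acc⟩ := d
    simp at *
    omega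
  have h₀ : ∀ (l acc : List Bool), l.foldl (fun (d : Bool × List Bool) b =>
      (d.1 && b, (bif d.1 then !b else b) :: d.2)) (false, acc) = (false, l.reverse ++ acc) := by
    intro l
    induction l with
    | nil => simp
    | cons b l ih => intro acc; simpa using ih (b :: acc)
  have h₁ : ∀ (l acc : List Bool),
      let d := l.foldl (fun (d : Bool × List Bool) b =>
        (d.1 && b, (bif d.1 then !b else b) :: d.2)) (true, acc)
      (bif d.1 then true :: d.2 else d.2).reverse = acc.reverse ++ PolyTime.incr l := by
    intro l
    induction l with
    | nil => simp [PolyTime.incr]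
    | cons b l ih =>
      intro acc
      cases b with
      | false => simp [PolyTime.incr, h₀]
      | true => simpa [PolyTime.incr] using ih (false :: acc)
  have : Poly fun a => (fun d : Bool × List Bool => (bif d.1 then true :: d.2 else d.2).reverse)
      ((l a).foldl (fun (d : Bool × List Bool) b =>
        (d.1 && b, (bif d.1 then !b else b) :: d.2)) (true, [])) :=
    comp (g := fun d : Bool × List Bool => (bif d.1 then true :: d.2 else d.2).reverse)
      (by fun_prop) key
  convert this using 2 with a
  simpa using (h₁ (l a) []).symm

/-- Constant additive growth, as `foldl` demands of the running index in `look`. -/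
theorem _root_.PolyTime.sz_incr_le (l : List Bool) : sz (PolyTime.incr l) ≤ sz l + 4 := by
  induction l with
  | nil => simp [PolyTime.incr]
  | cons b l ih =>
    cases b
    · simp [PolyTime.incr]; omega
    · simp [PolyTime.incr]; omega

@[fun_prop]
theorem look {k : α → List Bool} {l : α → List β} (hk : Poly k) (hl : Poly l) :
    Poly fun a => look (k a) (l a) := by
  have : Poly fun a => (l a).foldl (lookStep (k a)) ([], none) := by
    refine foldl hl (by fun_prop) ?_ (.X + 10) fun a d b => ?_
    · unfold lookStep
      fun_prop
    · obtain ⟨c, o⟩ := d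
      have := sz_incr_le c
      have := sz_pos o
      simp only [lookStep]
      cases PolyTime.all₂ BEq.beq (k a) c <;> simp <;> omega
  exact snd this

end Poly

end PolyTime

/-! ### The decision procedure -/

namespace S4FStandpoint

open PolyTime TreeEnc

/-- Enumeration of the input alphabet. -/
def Symbol.index : Symbol → ℕ
  | .bit false => 0
  | .bit true => 1
  | .sep => 2
  | .close => 3
  | .atom => 4
  | .neg => 5
  | .conj => 6
  | .box => 7
  | .sharpening => 8
  | .single => 9
  | .theory => 10
  | .everywhere => 11
  | .at => 12

instance : TreeEnc Symbol := ⟨fun s => tree (List.replicate s.index ())⟩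

theorem sz_symbol_le (s : Symbol) : sz s ≤ 25 := by
  have : ∀ n, sz (List.replicate n ()) = 2 * n + 1 := by
    intro n
    induction n with
    | zero => rfl
    | succ n ih =>
      rw [List.replicate_succ, sz_cons, ih, show sz () = 1 from rfl]
      omega
  have h : sz s = sz (List.replicate s.index ()) := rfl
  rw [h, this]
  have : s.index ≤ 12 := by rcases s with ⟨_ | _⟩ | _ <;> simp [Symbol.index]
  omega

/-- Boolean test for being the symbol `c`. -/
def isSym (c s : Symbol) : Bool := decide (s = c)

@[simp] theorem isSym_eq_true {c s : Symbol} : isSym c s = true ↔ s = c := by simp [isSym]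

@[simp] theorem isSym_self (c : Symbol) : isSym c c = true := by simp

theorem isSym_of_ne {c s : Symbol} (h : s ≠ c) : isSym c s = false := by simp [isSym, h]

/-- Comparison with a fixed tree unfolds, by recursion on that tree, into a finite nest of case
distinctions; no loop is needed. -/
theorem poly_isSym' (c : Symbol) : Poly (isSym c) := by
  have key : ∀ c : Tree, ∃ f : Tree → Bool, Poly f ∧ ∀ t, f t = true ↔ t = c := by
    intro c
    induction c with
    | nil =>
      refine ⟨fun t => match t with | .nil => true | .node _ _ => false, ?_, ?_⟩
      · refine Poly.case_of (h := fun t : Tree => t) (β := Tree) (n := fun _ => true)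
          (c := fun _ => false) (by fun_prop) (by fun_prop) (by fun_prop) fun t => ?_
        cases t with
        | nil => exact .inl ⟨rfl, rfl⟩
        | node l r => exact .inr ⟨.node l r, rfl, by simp [tree], rfl⟩
      · intro t; cases t <;> simp
    | node c₁ c₂ ih₁ ih₂ =>
      obtain ⟨f₁, h₁, h₁'⟩ := ih₁
      obtain ⟨f₂, h₂, h₂'⟩ := ih₂
      refine ⟨fun t => match t with | .nil => false | .node l r => f₁ l && f₂ r, ?_, ?_⟩
      · refine Poly.case_of (h := fun t : Tree => t) (β := Tree × Tree) (n := fun _ => false)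
          (c := fun x : Tree × Tree × Tree => f₁ x.2.1 && f₂ x.2.2)
          (by fun_prop) (by fun_prop) (by fun_prop) fun t => ?_
        cases t with
        | nil => exact .inl ⟨rfl, rfl⟩
        | node l r => exact .inr ⟨(l, r), rfl, by simp [tree_pair], rfl⟩
      · intro t; cases t <;> simp [h₁', h₂']
  obtain ⟨f, hf, h⟩ := key (tree c)
  have : Poly fun s : Symbol => f (tree s) :=
    hf.comp (Poly.of_tree_eq (f := fun s : Symbol => tree s) fun _ => rfl)
  convert this using 2 with s
  rw [Bool.eq_iff_iff, h, isSym_eq_true]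
  -- The unary codes of distinct indices differ, so equality of trees is equality of symbols.
  have hrep : ∀ m n, tree (List.replicate m ()) = tree (List.replicate n ()) → m = n := by
    intro m
    induction m with
    | zero => rintro (_ | n) h; · rfl
              simp [List.replicate_succ, tree_cons, tree_nil] at h
    | succ m ih =>
      rintro (_ | n) h
      · simp [List.replicate_succ, tree_cons, tree_nil] at h
      · simp only [List.replicate_succ, tree_cons, Tree.node.injEq, true_and] at h
        rw [ih n h]
  constructor
  · rintro rfl; rfl
  · intro h
    have := hrep _ _ h
    revert this
    rcases s with ⟨_ | _⟩ | _ <;> rcases c with ⟨_ | _⟩ | _ <;> simp [Symbol.index]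

@[fun_prop]
theorem poly_isSym {α : Type} [TreeEnc α] (c : Symbol) {f : α → Symbol} (hf : Poly f) :
    Poly fun a => isSym c (f a) := (poly_isSym' c).comp hf

/-- A symbol, or a bit string (when the symbol is `sep`). During the evaluation of queries, the
value of a formula is represented by the symbol `single` and a row of bits, and the value of a
sharpening statement by the symbol `sharpening` and a row of bits. -/
abbrev Token := Symbol × List Bool

/-- Split a word at the occurrences of `close`. -/
def sections (w : List Symbol) : List (List Symbol) :=
  w.foldr (fun s d => bif isSym .close s then [] :: d else
    lcase d [[s]] fun h t => (s :: h) :: t) [[]]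

/-- Prefix a sequence of tokens with a symbol. -/
def tokenStep (s : Symbol) (d : List Token) : List Token :=
  bif isSym (.bit true) s || isSym (.bit false) s then
    lcase d [(s, [])] fun t d' => bif isSym .sep t.1 then (.sep, isSym (.bit true) s :: t.2) :: d'
      else (s, []) :: d
  else (s, []) :: d

/-- Combine bit strings into single tokens. -/
def tokens (w : List Symbol) : List Token := w.foldr tokenStep []

/-- The tables of `σ`, `τ` and `γ`. -/
abbrev Tables := List (List Bool) × List (List Bool) × List (List Bool)

/-- The first row of a table. -/
def firstRow (l : List (List Bool)) : List Bool := lcase l [] fun r _ => r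

/-- The column of a table with binary index `k`. -/
def column (k : List Bool) (l : List (List Bool)) : Option (List Bool) :=
  ocase (look k (firstRow l)) none fun _ => some (l.map fun r => ocase (look k r) false fun b => b)

/-- Inclusion of sets given as bit rows. -/
def subRow (r u : List Bool) : Bool := all₂ (fun x y => !x || y) r u

/-- Negation of a bit row; `s` determines the length. -/
def negRow (s r : List Bool) : List Bool := (s.zip r).map fun x => !x.2

/-- Conjunction of bit rows; `s` determines the length. -/
def conjRow (s r u : List Bool) : List Bool := (s.zip (r.zip u)).map fun x => x.2.1 && x.2.2

/-- The modality whose inner and outer precisifications are `r` and `u`, applied to `v`; `s`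
is the set of inner precisifications of the universal standpoint. -/
def boxRow (s r u v : List Bool) : List Bool :=
  s.map fun x => subRow r v && (x || subRow u v)

/-- The constant row of the length of `s`. -/
def constRow (s : List Bool) (b : Bool) : List Bool := s.map fun _ => b

/-- Evaluate one token on a stack of values. -/
def evalStep (e : Tables) (t : Token) (st : List Token) : Option (List Token) :=
  bif isSym .sep t.1 then some (t :: st)
  else bif isSym .atom t.1 then
    lcase st none fun n st => bif isSym .sep n.1 then
      ocase (column n.2 e.2.2) none fun r => some ((.single, r) :: st) else none
  else bif isSym .neg t.1 then
    lcase st none fun v st => bif isSym .single v.1 then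
      some ((.single, negRow (firstRow e.1) v.2) :: st) else none
  else bif isSym .conj t.1 then
    lcase st none fun v st => lcase st none fun u st =>
      bif isSym .single v.1 && isSym .single u.1 then
        some ((.single, conjRow (firstRow e.1) v.2 u.2) :: st) else none
  else bif isSym .box t.1 then
    lcase st none fun n st => lcase st none fun v st =>
      bif isSym .sep n.1 && isSym .single v.1 then
        ocase (look n.2 e.1) none fun r => ocase (look n.2 e.2.1) none fun u =>
          some ((.single, boxRow (firstRow e.1) r u v.2) :: st)
      else none
  else bif isSym .sharpening t.1 then
    lcase st none fun n st => lcase st none fun m st =>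
      bif isSym .sep n.1 && isSym .sep m.1 then
        ocase (look n.2 e.1) none fun r => ocase (look n.2 e.2.1) none fun u =>
        ocase (look m.2 e.1) none fun r' => ocase (look m.2 e.2.1) none fun u' =>
          some ((.sharpening, constRow (firstRow e.1) (subRow r r' && subRow u u')) :: st)
      else none
  else none

/-- Evaluate a sequence of tokens from right to left. -/
def evalTokens (e : Tables) (ts : List Token) : Option (List Token) :=
  ts.foldr (fun t d => ocase d none fun st => evalStep e t st) (some [])

/-- Check that the tables represent a standpoint structure. -/
def validTables (e : Tables) : Bool :=
  !e.1.isEmpty &&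
  (e.1.all (fun r => all₂ (fun _ _ => true) r (firstRow e.1) && r.any fun x => x) &&
  (all₂ (fun _ r => all₂ (fun _ _ => true) r (firstRow e.1)) e.1 e.2.1 &&
  (all₂ (fun x y => x || y) (firstRow e.1) (firstRow e.2.1) &&
  (e.1.all (fun r => e.2.1.all fun u => all₂ (fun x y => !(x && y)) r u) &&
  (all₂ (fun _ _ => true) e.2.2 (firstRow e.1) &&
  e.2.2.all fun r => all₂ (fun _ _ => true) r (firstRow e.2.2))))))

/-- Check a value at a precisification, or everywhere. -/
def checkValue (pt : Option (List Bool)) (v : Token) : Bool :=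
  !isSym .sep v.1 && ocase pt (v.2.all fun b => b) fun k =>
    ocase (look k v.2) false fun b => b

/-- Check a query. -/
def checkQuery (e : Tables) (pt : Option (List Bool)) (isTheory : Bool) (ts : List Token) : Bool :=
  lcase ts false fun t ts => ocase (evalTokens e ts) false fun st =>
    bif isTheory then isSym .theory t.1 && st.all fun v => checkValue pt v
    else isSym .single t.1 && lcase st false fun v st => st.isEmpty && checkValue pt v

/-- Check a query that is preceded by an optional precisification. -/
def checkPointed (e : Tables) (isTheory : Bool) (ts : List Token) : Bool :=
  lcase ts false fun t ts =>
    bif isSym .everywhere t.1 then checkQuery e none isTheory ts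
    else isSym .at t.1 && lcase ts false fun n ts => isSym .sep n.1 &&
      ocase (look n.2 (firstRow e.1)) false fun _ => checkQuery e (some n.2) isTheory ts

/-- The rows of a section; the Boolean tells whether it is well-formed. -/
def rows (w : List Symbol) : Bool × List (List Bool) :=
  ((tokens w).all fun t => isSym .sep t.1, (tokens w).map fun t => t.2)

/-- The model checking algorithm, on a word that has been split into sections. -/
def checkSections (l : List (List Symbol)) : Bool :=
  lcase l false fun w₁ l => lcase l false fun w₂ l => lcase l false fun w₃ l =>
    lcase l false fun w₄ l =>
      (rows w₁).1 && ((rows w₂).1 && ((rows w₃).1 &&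
      (validTables ((rows w₁).2, (rows w₂).2, (rows w₃).2) &&
      (lcase l true (fun w l => w.isEmpty && l.isEmpty) &&
      checkPointed ((rows w₁).2, (rows w₂).2, (rows w₃).2) (!l.isEmpty) (tokens w₄)))))

/-! ### Polynomial running time of the decision procedure -/

section Poly

variable {α : Type} [TreeEnc α]

@[fun_prop]
theorem poly_sections {f : α → List Symbol} (hf : Poly f) : Poly fun a => sections (f a) := by
  refine Poly.foldr hf (by fun_prop) (by fun_prop) (.X + 10) fun a s d => ?_
  cases isSym .close s
  · cases d <;> simp <;> omega
  · simp; omega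

theorem sz_tokenStep_le (s : Symbol) (d : List Token) : sz (tokenStep s d) ≤ sz d + 40 := by
  have := sz_symbol_le s
  have := sz_symbol_le .sep
  have := sz_bool_le (isSym (.bit true) s)
  unfold tokenStep
  cases isSym (.bit true) s || isSym (.bit false) s
  · simp; omega
  · rcases d with _ | ⟨⟨x, l⟩, d⟩
    · simp
      omega
    · cases h : isSym .sep x
      · simp [h]; omega
      · have := sz_pos x
        obtain rfl := isSym_eq_true.1 h
        simp; omega

@[fun_prop]
theorem poly_tokens {f : α → List Symbol} (hf : Poly f) : Poly fun a => tokens (f a) := by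
  refine Poly.foldr hf (by fun_prop) ?_ (40 * .X) fun a s d => ?_
  · unfold tokenStep
    fun_prop
  · have := sz_tokenStep_le s d
    simp
    omega

@[fun_prop]
theorem poly_firstRow {f : α → List (List Bool)} (hf : Poly f) : Poly fun a => firstRow (f a) := by
  unfold firstRow
  fun_prop

@[fun_prop]
theorem poly_column {k : α → List Bool} {f : α → List (List Bool)} (hk : Poly k) (hf : Poly f) :
    Poly fun a => column (k a) (f a) := by
  unfold column
  fun_prop

@[fun_prop]
theorem poly_subRow {f g : α → List Bool} (hf : Poly f) (hg : Poly g) :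
    Poly fun a => subRow (f a) (g a) := by
  unfold subRow
  fun_prop

@[fun_prop]
theorem poly_negRow {s f : α → List Bool} (hs : Poly s) (hf : Poly f) :
    Poly fun a => negRow (s a) (f a) := by
  unfold negRow
  fun_prop

@[fun_prop]
theorem poly_conjRow {s f g : α → List Bool} (hs : Poly s) (hf : Poly f) (hg : Poly g) :
    Poly fun a => conjRow (s a) (f a) (g a) := by
  unfold conjRow
  fun_prop

@[fun_prop]
theorem poly_boxRow {s f g h : α → List Bool} (hs : Poly s) (hf : Poly f) (hg : Poly g)
    (hh : Poly h) : Poly fun a => boxRow (s a) (f a) (g a) (h a) := by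
  unfold boxRow
  fun_prop

@[fun_prop]
theorem poly_constRow {s : α → List Bool} {f : α → Bool} (hs : Poly s) (hf : Poly f) :
    Poly fun a => constRow (s a) (f a) := by
  unfold constRow
  fun_prop

@[fun_prop]
theorem poly_evalStep {e : α → Tables} {t : α → Token} {st : α → List Token} (he : Poly e)
    (ht : Poly t) (hst : Poly st) : Poly fun a => evalStep (e a) (t a) (st a) := by
  unfold evalStep
  fun_prop

theorem sz_firstRow_le (l : List (List Bool)) : sz (firstRow l) ≤ sz l := by
  cases l <;> simp [firstRow]
  omega

theorem sz_cond_le {c : Bool} {x y : α} {n : ℕ} (hx : sz x ≤ n) (hy : sz y ≤ n) :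
    sz (bif c then x else y) ≤ n := by
  cases c <;> assumption

theorem sz_ocase_le {β : Type} {o : Option β} {x : α} {f : β → α} {n : ℕ} (hx : sz x ≤ n)
    (hf : ∀ b, o = some b → sz (f b) ≤ n) : sz (ocase o x f) ≤ n := by
  cases o with
  | none => exact hx
  | some b => exact hf b rfl

theorem sz_lcase_le {β : Type} {l : List β} {x : α} {f : β → List β → α} {n : ℕ} (hx : sz x ≤ n)
    (hf : ∀ b t, l = b :: t → sz (f b t) ≤ n) : sz (lcase l x f) ≤ n := by
  cases l with
  | nil => exact hx
  | cons b t => exact hf b t rfl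

/-- The increment does not depend on the contents of the stack, as the fold in `evalTokens`
requires. Even on malformed input a new row is no longer than the first row of `σ`, or than the
number of rows of `γ` for an atom, because `negRow`, `conjRow`, `boxRow` and `constRow` take their
length from `firstRow`. -/
theorem sz_evalStep_le (e : Tables) (t : Token) (st : List Token) :
    sz (evalStep e t st) ≤ sz st + 4 * sz e + sz t + 40 := by
  obtain ⟨σ, τ, γ⟩ := e
  have h₀ := sz_pos st
  have h₁ := sz_firstRow_le σ
  have h₂ := length_lt_sz (firstRow σ)
  have h₃ := length_lt_sz γ
  have hs := sz_symbol_le .single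
  have hs' := sz_symbol_le .sharpening
  have hneg : ∀ r, sz (negRow (firstRow σ) r) ≤ 4 * sz σ := fun r => by
    have := sz_boolList_le (negRow (firstRow σ) r)
    simp only [negRow, List.length_map, List.length_zip] at this ⊢
    omega
  have hconj : ∀ r u, sz (conjRow (firstRow σ) r u) ≤ 4 * sz σ := fun r u => by
    have := sz_boolList_le (conjRow (firstRow σ) r u)
    simp only [conjRow, List.length_map, List.length_zip] at this ⊢
    omega
  have hbox : ∀ r u v, sz (boxRow (firstRow σ) r u v) ≤ 4 * sz σ := fun r u v => by
    have := sz_boolList_le (boxRow (firstRow σ) r u v)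
    simp only [boxRow, List.length_map] at this ⊢
    omega
  have hconst : ∀ b, sz (constRow (firstRow σ) b) ≤ 4 * sz σ := fun b => by
    have := sz_boolList_le (constRow (firstRow σ) b)
    simp only [constRow, List.length_map] at this ⊢
    omega
  have hcol : ∀ k r, column k γ = some r → sz r ≤ 4 * sz γ := fun k r h => by
    have := sz_boolList_le r
    unfold column at h
    cases h' : look k (firstRow γ) with
    | none => simp [h'] at h
    | some _ =>
      simp only [h', ocase_some, Option.some.injEq] at h
      have hr : r.length = γ.length := by rw [← h]; simp
      omega
  have hfin : ∀ (s : Symbol) (r : List Bool) (st' : List Token),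
      sz s ≤ 25 → sz r ≤ 4 * sz (σ, τ, γ) → sz st' ≤ sz st →
      sz (some ((s, r) :: st')) ≤ sz st + 4 * sz (σ, τ, γ) + sz t + 40 := by
    intro s r st' h₁ h₂ h₃
    simp at *
    omega
  have hnone : sz (none : Option (List Token)) ≤ sz st + 4 * sz (σ, τ, γ) + sz t + 40 := by
    rw [sz_none]
    omega
  have hσ : 4 * sz σ ≤ 4 * sz (σ, τ, γ) := by simp; omega
  have hγ : 4 * sz γ ≤ 4 * sz (σ, τ, γ) := by simp; omega
  have h_tail : ∀ (b : Token) (l l' : List Token), sz l' ≤ sz st → l' = b :: l →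
      sz l ≤ sz st := by
    rintro b l _ h rfl
    simp at h
    omega
  have hpush : sz (some (t :: st)) ≤ sz st + 4 * sz (σ, τ, γ) + sz t + 40 := by
    simp only [sz_some, sz_cons]
    omega
  unfold evalStep
  refine sz_cond_le hpush (sz_cond_le ?_ (sz_cond_le ?_ (sz_cond_le ?_ (sz_cond_le ?_
    (sz_cond_le ?_ hnone)))))
  · exact sz_lcase_le hnone fun n l hl => sz_cond_le (sz_ocase_le hnone fun r hr =>
      hfin _ _ _ hs ((hcol _ _ hr).trans hγ) (h_tail _ _ _ le_rfl hl)) hnone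
  · exact sz_lcase_le hnone fun n l hl => sz_cond_le
      (hfin _ _ _ hs ((hneg _).trans hσ) (h_tail _ _ _ le_rfl hl)) hnone
  · exact sz_lcase_le hnone fun n l hl => sz_lcase_le hnone fun m l' hl' => sz_cond_le
      (hfin _ _ _ hs ((hconj _ _).trans hσ) (h_tail _ _ _ (h_tail _ _ _ le_rfl hl) hl')) hnone
  · exact sz_lcase_le hnone fun n l hl => sz_lcase_le hnone fun m l' hl' => sz_cond_le
      (sz_ocase_le hnone fun _ _ => sz_ocase_le hnone fun _ _ => hfin _ _ _ hs
        ((hbox _ _ _).trans hσ) (h_tail _ _ _ (h_tail _ _ _ le_rfl hl) hl')) hnone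
  · exact sz_lcase_le hnone fun n l hl => sz_lcase_le hnone fun m l' hl' => sz_cond_le
      (sz_ocase_le hnone fun _ _ => sz_ocase_le hnone fun _ _ => sz_ocase_le hnone fun _ _ =>
        sz_ocase_le hnone fun _ _ => hfin _ _ _ hs' ((hconst _).trans hσ)
        (h_tail _ _ _ (h_tail _ _ _ le_rfl hl) hl')) hnone

@[fun_prop]
theorem poly_evalTokens {e : α → Tables} {f : α → List Token} (he : Poly e) (hf : Poly f) :
    Poly fun a => evalTokens (e a) (f a) := by
  obtain ⟨T, hT⟩ := he.sz_le
  refine Poly.foldr hf (by fun_prop) (by fun_prop) (4 * T + .X + 40) fun a t d => ?_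
  cases d with
  | none => simp
  | some st =>
    have h₁ := sz_evalStep_le (e a) t st
    have h₂ := hT a
    have h₃ := eval_mono T (show sz a ≤ sz (a, t) by rw [sz_pair]; omega)
    simp only [ocase_some, sz_some, Polynomial.eval_add, Polynomial.eval_mul, Polynomial.eval_X,
      Polynomial.eval_ofNat]
    rw [sz_pair] at *
    omega

@[fun_prop]
theorem poly_validTables {e : α → Tables} (he : Poly e) : Poly fun a => validTables (e a) := by
  unfold validTables
  fun_prop

@[fun_prop]
theorem poly_checkValue {pt : α → Option (List Bool)} {v : α → Token} (hp : Poly pt)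
    (hv : Poly v) : Poly fun a => checkValue (pt a) (v a) := by
  unfold checkValue
  fun_prop

@[fun_prop]
theorem poly_checkQuery {e : α → Tables} {pt : α → Option (List Bool)} {b : α → Bool}
    {ts : α → List Token} (he : Poly e) (hp : Poly pt) (hb : Poly b) (hts : Poly ts) :
    Poly fun a => checkQuery (e a) (pt a) (b a) (ts a) := by
  unfold checkQuery
  fun_prop

@[fun_prop]
theorem poly_checkPointed {e : α → Tables} {b : α → Bool} {ts : α → List Token} (he : Poly e)
    (hb : Poly b) (hts : Poly ts) : Poly fun a => checkPointed (e a) (b a) (ts a) := by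
  unfold checkPointed
  fun_prop

@[fun_prop]
theorem poly_rows {f : α → List Symbol} (hf : Poly f) : Poly fun a => rows (f a) := by
  unfold rows
  fun_prop

theorem poly_checkSections : Poly checkSections := by
  unfold checkSections
  fun_prop

end Poly

end S4FStandpoint

/-! ### Correctness of the decomposition of words and of the tables -/

namespace S4FStandpoint

open PolyTime

theorem sections_close (w : List Symbol) : sections (.close :: w) = [] :: sections w := by
  simp [sections]

theorem sections_ne_nil (w : List Symbol) : sections w ≠ [] := by
  cases w with
  | nil => simp [sections]
  | cons s w =>
    simp only [sections, List.foldr_cons]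
    cases isSym .close s
    · cases List.foldr _ _ w <;> simp
    · simp

theorem sections_cons {s : Symbol} (hs : s ≠ .close) {w h : List Symbol} {t : List (List Symbol)}
    (hw : sections w = h :: t) : sections (s :: w) = (s :: h) :: t := by
  simp only [sections, List.foldr_cons, isSym_of_ne hs, cond_false] at hw ⊢
  rw [hw, lcase_cons]

theorem sections_append_close {w : List Symbol} (hw : .close ∉ w) (r : List Symbol) :
    sections (w ++ .close :: r) = w :: sections r := by
  induction w with
  | nil => exact sections_close r
  | cons s w ih =>
    simp only [List.mem_cons, not_or] at hw
    exact sections_cons (Ne.symm hw.1) (ih hw.2)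

theorem sections_eq_singleton {w : List Symbol} (hw : .close ∉ w) : sections w = [w] := by
  induction w with
  | nil => rfl
  | cons s w ih =>
    simp only [List.mem_cons, not_or] at hw
    exact sections_cons (Ne.symm hw.1) (ih hw.2)

/-- Splitting is reversible; this rebuilds an accepted word from its sections. -/
theorem eq_of_sections_eq_cons {w w₁ : List Symbol} {l : List (List Symbol)}
    (h : sections w = w₁ :: l) :
    (l = [] ∧ w = w₁) ∨ ∃ r, w = w₁ ++ .close :: r ∧ sections r = l := by
  induction w generalizing w₁ l with
  | nil =>
    simp only [sections, List.foldr_nil, List.cons.injEq] at h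
    exact .inl ⟨h.2.symm, h.1⟩
  | cons s w ih =>
    by_cases hs : s = .close
    · subst hs
      rw [sections_close, List.cons.injEq] at h
      exact .inr ⟨w, by simp [← h.1], h.2⟩
    · obtain ⟨h', t, e⟩ := List.exists_cons_of_ne_nil (sections_ne_nil w)
      rw [sections_cons hs e, List.cons.injEq] at h
      obtain ⟨rfl, rfl⟩ := h
      rcases ih e with ⟨h₁, h₂⟩ | ⟨r, h₁, h₂⟩
      · exact .inl ⟨h₁, by rw [h₂]⟩
      · exact .inr ⟨r, by rw [h₁]; rfl, h₂⟩

theorem tokens_cons_of_ne_bit {s : Symbol} (hs : ∀ b, s ≠ .bit b) (w : List Symbol) :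
    tokens (s :: w) = (s, []) :: tokens w := by
  simp [tokens, tokenStep, isSym_of_ne (hs _)]

theorem tokens_encBits (l : List Bool) (w : List Symbol) :
    tokens (encBits l ++ w) = (.sep, l) :: tokens w := by
  induction l with
  | nil => exact tokens_cons_of_ne_bit (by simp) w
  | cons b l ih =>
    have : tokens (encBits (b :: l) ++ w) = tokenStep (.bit b) (tokens (encBits l ++ w)) := rfl
    rw [this, ih]
    cases b <;> simp [tokenStep, isSym]

/-- Tokenization loses nothing: a bit is absorbed only into a bit string that ends in `sep`, and any
other bit is a token of its own. -/
theorem eq_of_tokens_eq_cons {w : List Symbol} {t : Token} {ts : List Token}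
    (h : tokens w = t :: ts) :
    ∃ r, w = t.2.map .bit ++ t.1 :: r ∧ tokens r = ts ∧ (t.1 ≠ .sep → t.2 = []) := by
  induction w generalizing t ts with
  | nil => simp [tokens] at h
  | cons s w ih =>
    by_cases hs : ∀ b, s ≠ .bit b
    · rw [tokens_cons_of_ne_bit hs, List.cons.injEq] at h
      obtain ⟨rfl, rfl⟩ := h
      exact ⟨w, by simp⟩
    · push Not at hs
      obtain ⟨b, rfl⟩ := hs
      have e : tokens (.bit b :: w) = tokenStep (.bit b) (tokens w) := rfl
      have hb : (isSym (.bit true) (.bit b) || isSym (.bit false) (.bit b)) = true := by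
        cases b <;> simp
      rw [e] at h
      simp only [tokenStep, hb, cond_true] at h
      rcases hw : tokens w with _ | ⟨u, us⟩
      · rw [hw, lcase_nil, List.cons.injEq] at h
        obtain ⟨rfl, rfl⟩ := h
        exact ⟨w, by simp [hw]⟩
      · rw [hw, lcase_cons] at h
        by_cases hu : u.1 = .sep
        · rw [hu, isSym_self, cond_true, List.cons.injEq] at h
          obtain ⟨rfl, rfl⟩ := h
          obtain ⟨r, h₁, h₂, -⟩ := ih hw
          refine ⟨r, ?_, h₂, by simp⟩
          rw [h₁, hu]
          cases b <;> simp [isSym]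
        · rw [isSym_of_ne hu, cond_false, List.cons.injEq] at h
          obtain ⟨rfl, rfl⟩ := h
          exact ⟨w, by simp [hw]⟩

theorem eq_nil_of_tokens_eq_nil {w : List Symbol} (h : tokens w = []) : w = [] := by
  cases w with
  | nil => rfl
  | cons s w =>
    have e : tokens (s :: w) = tokenStep s (tokens w) := rfl
    rw [e, tokenStep] at h
    cases hb : isSym (.bit true) s || isSym (.bit false) s
    · simp [hb] at h
    · rw [hb, cond_true] at h
      rcases hw : tokens w with _ | ⟨u, us⟩
      · simp [hw] at h
      · cases hu : isSym .sep u.1 <;> simp [hw, hu] at h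

theorem tokens_flatMap_encBits (l : List (List Bool)) :
    tokens (l.flatMap encBits) = l.map fun r => (.sep, r) := by
  induction l with
  | nil => rfl
  | cons r l ih => rw [List.flatMap_cons, tokens_encBits, ih, List.map_cons]

theorem rows_flatMap_encBits (l : List (List Bool)) : rows (l.flatMap encBits) = (true, l) := by
  simp [rows, tokens_flatMap_encBits]

theorem eq_of_rows {w : List Symbol} (h : (rows w).1 = true) :
    w = (rows w).2.flatMap encBits := by
  simp only [rows] at h ⊢
  generalize hts : tokens w = ts at h
  induction ts generalizing w with
  | nil => simp [eq_nil_of_tokens_eq_nil hts]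
  | cons t ts ih =>
    obtain ⟨r, h₁, h₂, -⟩ := eq_of_tokens_eq_cons hts
    simp only [List.all_cons, Bool.and_eq_true, isSym_eq_true] at h
    rw [h₁, ih h₂ h.2, h.1]
    simp [encBits]

/-! ### Bit rows as subsets -/

section rows

variable {n : ℕ} {X Y : Set (Fin n)}

@[simp] theorem length_bitRow (X : Set (Fin n)) : (bitRow X).length = n := by simp [bitRow]

theorem getElem?_bitRow (X : Set (Fin n)) (i : Fin n) :
    (bitRow X)[(i : ℕ)]? = some (open Classical in decide (i ∈ X)) := by
  simp [bitRow]

theorem eq_bitRow (l : List Bool) (h : l.length = n) : ∃ X : Set (Fin n), l = bitRow X := by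
  subst h
  exact ⟨{i | l[i] = true}, List.ext_getElem (by simp) fun i h₁ h₂ => by simp [bitRow]⟩

theorem eq_bitRow_of_getElem {l : List Bool} {Z : Set (Fin n)} (hl : l.length = n)
    (h : ∀ i : Fin n, l[(i : ℕ)] = true ↔ i ∈ Z) : l = bitRow Z := by
  refine List.ext_getElem (by simp [hl]) fun i h₁ h₂ => ?_
  rw [Bool.eq_iff_iff, h ⟨i, by omega⟩]
  simp [bitRow]

theorem getElem_bitRow {i : ℕ} (h : i < (bitRow X).length) :
    (bitRow X)[i] = true ↔ (⟨i, by simpa using h⟩ : Fin n) ∈ X := by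
  simp [bitRow]

theorem subRow_bitRow : subRow (bitRow X) (bitRow Y) = true ↔ X ⊆ Y := by
  simp only [subRow, all₂_iff, List.forall₂_iff_get, List.get_eq_getElem, Bool.or_eq_true,
    Bool.not_eq_true', length_bitRow, true_and, ← Bool.not_eq_true, getElem_bitRow]
  constructor
  · intro h i hi
    exact (h i i.2 i.2).resolve_left (not_not.2 hi)
  · intro h i h₁ _
    exact or_iff_not_imp_left.2 fun hi => h (not_not.1 hi)

theorem negRow_bitRow (S : Set (Fin n)) : negRow (bitRow S) (bitRow X) = bitRow Xᶜ := by
  refine eq_bitRow_of_getElem (by simp [negRow]) fun i => ?_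
  simp [negRow, bitRow]

theorem conjRow_bitRow (S : Set (Fin n)) :
    conjRow (bitRow S) (bitRow X) (bitRow Y) = bitRow (X ∩ Y) := by
  refine eq_bitRow_of_getElem (by simp [conjRow]) fun i => ?_
  simp [conjRow, bitRow]

theorem constRow_bitRow (S : Set (Fin n)) (b : Bool) :
    constRow (bitRow S) b = bitRow {_i : Fin n | b = true} := by
  refine eq_bitRow_of_getElem (by simp [constRow]) fun i => ?_
  simp [constRow]

theorem boxRow_bitRow (S R U V : Set (Fin n)) :
    boxRow (bitRow S) (bitRow R) (bitRow U) (bitRow V) =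
      bitRow {i | R ⊆ V ∧ (i ∈ S ∨ U ⊆ V)} := by
  refine eq_bitRow_of_getElem (by simp [boxRow]) fun i => ?_
  simp [boxRow, subRow_bitRow, getElem_bitRow]

theorem all_bitRow : ((bitRow X).all fun b => b) = true ↔ ∀ i, i ∈ X := by
  simp [bitRow, List.mem_ofFn, List.all_eq_true]

theorem any_bitRow : ((bitRow X).any fun b => b) = true ↔ X.Nonempty := by
  simp [bitRow, List.mem_ofFn, Set.Nonempty]

theorem all₂_bitRow {r : Bool → Bool → Bool} :
    all₂ r (bitRow X) (bitRow Y) = true ↔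
      ∀ i : Fin n, r (open Classical in decide (i ∈ X)) (open Classical in decide (i ∈ Y)) := by
  simp only [all₂_iff, List.forall₂_iff_get, List.get_eq_getElem, length_bitRow, true_and]
  constructor
  · intro h i
    simpa [bitRow] using h i i.2 i.2
  · intro h i h₁ _
    simpa [bitRow] using h ⟨i, h₁⟩

theorem look_ofFn {β : Type} (f : Fin n → β) (i : Fin n) :
    look (Computability.encodeNat i) (List.ofFn f) = some (f i) := by
  simp [look_encodeNat]

theorem exists_of_look_ofFn {β : Type} {f : Fin n → β} {k : List Bool} {b : β}
    (h : look k (List.ofFn f) = some b) : ∃ i : Fin n, k = Computability.encodeNat i ∧ b = f i := by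
  obtain ⟨i, hk, h⟩ := look_eq_some.1 h
  rw [List.getElem?_eq_some_iff] at h
  obtain ⟨hi, h⟩ := h
  exact ⟨⟨i, by simpa using hi⟩, hk, by rw [← h]; simp⟩

end rows

/-- The table of a family of sets. -/
noncomputable def table {m n : ℕ} (X : Fin m → Set (Fin n)) : List (List Bool) :=
  List.ofFn fun i => bitRow (X i)

theorem firstRow_table {m n : ℕ} (X : Fin (m + 1) → Set (Fin n)) :
    firstRow (table X) = bitRow (X 0) := by
  simp [table, firstRow, List.ofFn_succ]

theorem exists_eq_table {l : List (List Bool)} {m n : ℕ} (hl : l.length = m)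
    (h : ∀ r ∈ l, r.length = n) : ∃ X : Fin m → Set (Fin n), l = table X := by
  subst hl
  choose X hX using fun i : Fin l.length => eq_bitRow l[i] (h l[i] (by simp))
  refine ⟨X, List.ext_getElem (by simp [table]) fun i h₁ h₂ => ?_⟩
  simpa [table] using hX ⟨i, h₁⟩

theorem column_table {m n : ℕ} (X : Fin (m + 1) → Set (Fin n)) (i : Fin n) :
    column (Computability.encodeNat i) (table X) = some (bitRow {j | i ∈ X j}) := by
  have h : ∀ j, look (Computability.encodeNat i) (bitRow (X j)) = _ := fun j => by
    rw [look_encodeNat, getElem?_bitRow]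
  simp only [column, firstRow_table, h, ocase_some, Option.some.injEq]
  refine eq_bitRow_of_getElem (by simp [table, -List.ofFn_succ]) fun j => ?_
  simp [table, h, -List.ofFn_succ]

theorem exists_of_column_table {m n : ℕ} {X : Fin (m + 1) → Set (Fin n)} {k r : List Bool}
    (h : column k (table X) = some r) :
    ∃ i : Fin n, k = Computability.encodeNat i ∧ r = bitRow {j | i ∈ X j} := by
  have h' : ∃ b, look k (bitRow (X 0)) = some b := by
    simp only [column, firstRow_table] at h
    cases hb : look k (bitRow (X 0)) with
    | none => simp [hb] at h
    | some b => exact ⟨b, rfl⟩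
  obtain ⟨b, hb⟩ := h'
  obtain ⟨i, rfl, -⟩ := exists_of_look_ofFn hb
  rw [column_table, Option.some.injEq] at h
  exact ⟨i, rfl, h.symm⟩

/-! ### Tables that represent standpoint structures -/

section Structure

variable {a s p : ℕ} (F : StandpointStructure (Fin a) (Fin (s + 1)) 0 (Fin p))

/-- The tables of a standpoint structure. -/
noncomputable def tables : Tables := (table F.σ, table F.τ, table F.γ)

theorem validTables_tables : validTables (tables F) = true := by
  obtain ⟨q⟩ := F.nonempty
  -- The table of `γ` has one row per precisification, so a first row exists.
  obtain ⟨p, rfl⟩ : ∃ p', p = p' + 1 := ⟨p - 1, by have := q.pos; omega⟩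
  simp only [validTables, tables, firstRow_table, Bool.and_eq_true, all₂_true, List.all_eq_true,
    all₂_bitRow]
  refine ⟨by simp [table], ?_, ?_, ?_, ?_, by simp [table], ?_⟩
  · simp only [table, List.mem_ofFn, forall_exists_index, forall_apply_eq_imp_iff, length_bitRow,
      any_bitRow, true_and]
    exact F.inner_nonempty
  · rw [all₂_iff, List.forall₂_iff_get]
    simp [table, all₂_true, -List.ofFn_succ]
  · intro i
    have := F.star_universal ▸ Set.mem_univ i
    simpa using this
  · simp only [table, List.mem_ofFn, forall_exists_index, forall_apply_eq_imp_iff, all₂_bitRow]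
    intro t u i
    have : i ∉ F.σ t ∩ F.τ u := by rw [F.inner_outer_disjoint]; simp
    simpa [← not_and_or] using this
  · simp [table]

end Structure

/-- The numbers of precisifications and atoms are the lengths of the first rows of `σ` and `γ`; the
tests then supply the dimensions of the tables and the axioms of a structure. -/
theorem exists_of_validTables {e : Tables} (h : validTables e = true) :
    ∃ (a s p : ℕ) (F : StandpointStructure (Fin a) (Fin (s + 1)) 0 (Fin p)), e = tables F := by
  obtain ⟨σ, τ, γ⟩ := e
  simp only [validTables, Bool.and_eq_true, all₂_true, List.all_eq_true] at h
  obtain ⟨h₀, h₁, h₂, h₃, h₄, h₅, h₆⟩ := h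
  obtain ⟨s, hs⟩ : ∃ s, σ.length = s + 1 := by
    cases σ with
    | nil => simp at h₀
    | cons r l => exact ⟨l.length, rfl⟩
  rw [all₂_iff] at h₂
  have hτ : τ.length = s + 1 := by rw [← h₂.length_eq, hs]
  have hτ' : ∀ r ∈ τ, r.length = (firstRow σ).length := by
    intro r hr
    obtain ⟨i, hi, rfl⟩ := List.getElem_of_mem hr
    simpa [all₂_true] using (List.forall₂_iff_get.1 h₂).2 i (by omega) hi
  obtain ⟨X, hX⟩ := exists_eq_table hs fun r hr => (h₁ r hr).1
  obtain ⟨Y, hY⟩ := exists_eq_table hτ hτ'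
  obtain ⟨Z, hZ⟩ := exists_eq_table h₅ h₆
  generalize (firstRow σ).length = p at *
  generalize (firstRow γ).length = a at *
  subst hX hY hZ
  simp only [firstRow_table, all₂_bitRow] at h₃
  simp only [table, List.mem_ofFn, forall_exists_index, forall_apply_eq_imp_iff, any_bitRow,
    all₂_bitRow] at h₁ h₄
  -- A precisification exists because the row of the universal standpoint in `σ` is not zero.
  obtain ⟨i, -⟩ := (h₁ 0).2
  refine ⟨a, s, p, ⟨⟨i⟩, X, Y, Z, ?_, fun t => (h₁ t).2, ?_⟩, rfl⟩
  · ext i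
    simpa using h₃ i
  · intro t u
    ext i
    simpa [← not_and_or] using h₄ t u i

end S4FStandpoint

/-! ### Correctness of the evaluation of queries -/

namespace S4FStandpoint

open PolyTime

section Eval

variable {a s p : ℕ} (F : StandpointStructure (Fin a) (Fin (s + 1)) 0 (Fin p))

/-- The value of a bit string or of an expression. -/
noncomputable def value : List Bool ⊕ Expression (Fin a) (Fin (s + 1)) → Token
  | .inl l => (.sep, l)
  | .inr (.sharpening t u) => (.sharpening, bitRow {π | F.Sat π (.sharpening t u)})
  | .inr (.formula ψ) => (.single, bitRow {π | F.SatFormula π ψ})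

/-- The word for a bit string or an expression. -/
def encItem : List Bool ⊕ Expression (Fin a) (Fin (s + 1)) → List Symbol
  | .inl l => encBits l
  | .inr φ => encExpression φ

variable {F}

theorem evalTokens_cons (e : Tables) (t : Token) (ts : List Token) :
    evalTokens e (t :: ts) = ocase (evalTokens e ts) none fun st => evalStep e t st := rfl

theorem evalTokens_encBits {e : Tables} {l : List Bool} {w : List Symbol} {st : List Token}
    (h : evalTokens e (tokens w) = some st) :
    evalTokens e (tokens (encBits l ++ w)) = some ((.sep, l) :: st) := by
  simp [tokens_encBits, evalTokens_cons, h, evalStep]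

theorem evalTokens_encNat {e : Tables} {n : ℕ} {w : List Symbol} {st : List Token}
    (h : evalTokens e (tokens w) = some st) :
    evalTokens e (tokens (encNat n ++ w)) = some ((.sep, Computability.encodeNat n) :: st) :=
  evalTokens_encBits h

theorem evalTokens_symbol {e : Tables} {c : Symbol} (hc : ∀ b, c ≠ .bit b) {w : List Symbol}
    {st : List Token} (h : evalTokens e (tokens w) = some st) :
    evalTokens e (tokens (c :: w)) = evalStep e (c, []) st := by
  simp [tokens_cons_of_ne_bit hc, evalTokens_cons, h]

theorem firstRow_tables : firstRow (tables F).1 = bitRow (F.σ 0) := firstRow_table _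

/-- Inclusion of `σ t ∪ τ t` splits into two inclusions, and the disjunct for `σ 0` switches off the
one for `τ t` at its members. -/
theorem boxRow_eq (t : Fin (s + 1)) (ψ : Formula (Fin a) (Fin (s + 1))) :
    boxRow (bitRow (F.σ 0)) (bitRow (F.σ t)) (bitRow (F.τ t)) (bitRow {π | F.SatFormula π ψ}) =
      bitRow {π | F.SatFormula π (.box t ψ)} := by
  rw [boxRow_bitRow]
  congr 1
  ext π
  simp only [Set.mem_ofPred_eq, StandpointStructure.SatFormula, Set.subset_def, Set.mem_union]
  by_cases h : π ∈ F.σ 0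
  · simp [h]
  · simp only [h, false_or, false_imp_iff, not_false_eq_true, true_imp_iff, true_and]
    constructor
    · rintro ⟨h₁, h₂⟩ π' (h | h)
      exacts [h₁ _ h, h₂ _ h]
    · exact fun h => ⟨fun π' h' => h π' (.inl h'), fun π' h' => h π' (.inr h')⟩

theorem sharpening_eq (t u : Fin (s + 1)) :
    constRow (bitRow (F.σ 0)) (subRow (bitRow (F.σ t)) (bitRow (F.σ u)) &&
      subRow (bitRow (F.τ t)) (bitRow (F.τ u))) = bitRow {π | F.Sat π (.sharpening t u)} := by
  rw [constRow_bitRow]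
  congr 1
  ext π
  simp [StandpointStructure.Sat, subRow_bitRow]

theorem evalStep_sep (e : Tables) (l : List Bool) (st : List Token) :
    evalStep e (.sep, l) st = some ((.sep, l) :: st) := by
  simp [evalStep]

theorem column_tables (q : Fin a) : column (Computability.encodeNat q) (tables F).2.2 =
    some (bitRow {π | F.SatFormula π (.atom q)}) := by
  obtain ⟨i⟩ := F.nonempty
  obtain ⟨p, rfl⟩ : ∃ p', p = p' + 1 := ⟨p - 1, by have := i.pos; omega⟩
  exact column_table F.γ q

theorem exists_of_column_tables {k r : List Bool} (h : column k (tables F).2.2 = some r) :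
    ∃ q : Fin a, k = Computability.encodeNat q ∧ r = bitRow {π | F.SatFormula π (.atom q)} := by
  obtain ⟨i⟩ := F.nonempty
  obtain ⟨p, rfl⟩ : ∃ p', p = p' + 1 := ⟨p - 1, by have := i.pos; omega⟩
  exact exists_of_column_table h

theorem look_σ (t : Fin (s + 1)) :
    look (Computability.encodeNat t) (tables F).1 = some (bitRow (F.σ t)) := look_ofFn _ t

theorem look_τ (t : Fin (s + 1)) :
    look (Computability.encodeNat t) (tables F).2.1 = some (bitRow (F.τ t)) := look_ofFn _ t

theorem exists_of_look_σ {k r : List Bool} (h : look k (tables F).1 = some r) :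
    ∃ t : Fin (s + 1), k = Computability.encodeNat t ∧ r = bitRow (F.σ t) := exists_of_look_ofFn h

theorem evalStep_atom (q : Fin a) (st : List Token) :
    evalStep (tables F) (.atom, []) ((.sep, Computability.encodeNat q) :: st) =
      some (value F (.inr (.formula (.atom q))) :: st) := by
  simp [evalStep, isSym, column_tables, value]

theorem evalStep_neg (ψ : Formula (Fin a) (Fin (s + 1))) (st : List Token) :
    evalStep (tables F) (.neg, []) (value F (.inr (.formula ψ)) :: st) =
      some (value F (.inr (.formula (.neg ψ))) :: st) := by
  simp [evalStep, isSym, value, firstRow_tables, negRow_bitRow, Set.compl_ofPred,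
    StandpointStructure.SatFormula]

theorem evalStep_conj (ψ₁ ψ₂ : Formula (Fin a) (Fin (s + 1))) (st : List Token) :
    evalStep (tables F) (.conj, [])
      (value F (.inr (.formula ψ₁)) :: value F (.inr (.formula ψ₂)) :: st) =
      some (value F (.inr (.formula (.conj ψ₁ ψ₂))) :: st) := by
  simp [evalStep, isSym, value, firstRow_tables, conjRow_bitRow, Set.ofPred_and,
    StandpointStructure.SatFormula]

theorem evalStep_box (t : Fin (s + 1)) (ψ : Formula (Fin a) (Fin (s + 1))) (st : List Token) :
    evalStep (tables F) (.box, [])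
      ((.sep, Computability.encodeNat t) :: value F (.inr (.formula ψ)) :: st) =
      some (value F (.inr (.formula (.box t ψ))) :: st) := by
  simp [evalStep, isSym, value, firstRow_tables, look_σ, look_τ, boxRow_eq]

theorem evalStep_sharpening (t u : Fin (s + 1)) (st : List Token) :
    evalStep (tables F) (.sharpening, [])
      ((.sep, Computability.encodeNat t) :: (.sep, Computability.encodeNat u) :: st) =
      some (value F (.inr (.sharpening t u)) :: st) := by
  simp [evalStep, isSym, value, firstRow_tables, look_σ, look_τ, sharpening_eq]

/-- Reading from the right, the operands are evaluated before their connective, the first operand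
ending on top. Arbitrary `w` and `st` let the induction hypotheses be chained. -/
theorem evalTokens_encFormula (ψ : Formula (Fin a) (Fin (s + 1))) {w : List Symbol}
    {st : List Token} (h : evalTokens (tables F) (tokens w) = some st) :
    evalTokens (tables F) (tokens (encFormula ψ ++ w)) =
      some (value F (.inr (.formula ψ)) :: st) := by
  induction ψ generalizing w st with
  | atom q =>
    rw [← evalStep_atom, encFormula, List.cons_append,
      evalTokens_symbol (by simp) (evalTokens_encNat h)]
  | neg ψ ih =>
    rw [← evalStep_neg, encFormula, List.cons_append, evalTokens_symbol (by simp) (ih h)]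
  | conj ψ₁ ψ₂ ih₁ ih₂ =>
    rw [← evalStep_conj, encFormula, List.cons_append, List.append_assoc,
      evalTokens_symbol (by simp) (ih₁ (ih₂ h))]
  | box t ψ ih =>
    rw [← evalStep_box, encFormula, List.cons_append, List.append_assoc,
      evalTokens_symbol (by simp) (evalTokens_encNat (ih h))]

theorem evalTokens_encExpression (φ : Expression (Fin a) (Fin (s + 1))) {w : List Symbol}
    {st : List Token} (h : evalTokens (tables F) (tokens w) = some st) :
    evalTokens (tables F) (tokens (encExpression φ ++ w)) = some (value F (.inr φ) :: st) := by
  cases φ with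
  | formula ψ => exact evalTokens_encFormula ψ h
  | sharpening t u =>
    rw [← evalStep_sharpening, encExpression, List.cons_append, List.append_assoc,
      evalTokens_symbol (by simp) (evalTokens_encNat (evalTokens_encNat h))]

theorem evalTokens_flatMap (T : List (Expression (Fin a) (Fin (s + 1)))) :
    evalTokens (tables F) (tokens (T.flatMap encExpression)) =
      some (T.map fun φ => value F (.inr φ)) := by
  induction T with
  | nil => rfl
  | cons φ T ih => rw [List.flatMap_cons, evalTokens_encExpression φ ih, List.map_cons]

/-! ### Recovering expressions from successful evaluations -/

theorem eq_inl_of_value {x : List Bool ⊕ Expression (Fin a) (Fin (s + 1))}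
    (h : (value F x).1 = .sep) : x = .inl (value F x).2 := by
  rcases x with l | _ | _ <;> simp [value] at h ⊢

theorem eq_formula_of_value {x : List Bool ⊕ Expression (Fin a) (Fin (s + 1))}
    (h : (value F x).1 = .single) : ∃ ψ, x = .inr (.formula ψ) := by
  rcases x with l | _ | ψ <;> simp [value] at h ⊢

/-- The tag of a value tells whether it stems from a bit string, a formula or a sharpening
statement, and a successful lookup shows that a bit string is a legitimate index. The operands of a
successful step thus fit the connective and combine into an expression. -/
theorem exists_of_evalStep {c : Symbol} (hc : c ≠ .sep)
    {l : List (List Bool ⊕ Expression (Fin a) (Fin (s + 1)))} {st : List Token}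
    (h : evalStep (tables F) (c, []) (l.map (value F)) = some st) :
    ∃ l' : List (List Bool ⊕ Expression (Fin a) (Fin (s + 1))),
      st = l'.map (value F) ∧ l'.flatMap encItem = c :: l.flatMap encItem := by
  by_cases hatom : c = .atom
  · subst hatom
    rcases l with _ | ⟨n, l⟩
    · simp [evalStep, isSym] at h
    by_cases hn : (value F n).1 = .sep
    swap
    · simp [evalStep, isSym, hn] at h
    obtain ⟨k, rfl⟩ : ∃ k, n = .inl k := ⟨_, eq_inl_of_value hn⟩
    cases hr : column k (tables F).2.2 with
    | none => simp [evalStep, isSym, value, hr] at h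
    | some r =>
      obtain ⟨q, rfl, -⟩ := exists_of_column_tables hr
      rw [List.map_cons, value, evalStep_atom, Option.some.injEq] at h
      exact ⟨.inr (.formula (.atom q)) :: l, h.symm, rfl⟩
  by_cases hneg : c = .neg
  · subst hneg
    rcases l with _ | ⟨n, l⟩
    · simp [evalStep, isSym] at h
    by_cases hn : (value F n).1 = .single
    swap
    · simp [evalStep, isSym, hn] at h
    obtain ⟨ψ, rfl⟩ := eq_formula_of_value hn
    rw [List.map_cons, evalStep_neg, Option.some.injEq] at h
    exact ⟨.inr (.formula (.neg ψ)) :: l, h.symm, rfl⟩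
  by_cases hconj : c = .conj
  · subst hconj
    rcases l with _ | ⟨m, _ | ⟨n, l⟩⟩
    · simp [evalStep, isSym] at h
    · simp [evalStep, isSym] at h
    by_cases hm : (value F m).1 = .single
    swap
    · simp [evalStep, isSym, hm] at h
    by_cases hn : (value F n).1 = .single
    swap
    · simp [evalStep, isSym, hn] at h
    obtain ⟨ψ₁, rfl⟩ := eq_formula_of_value hm
    obtain ⟨ψ₂, rfl⟩ := eq_formula_of_value hn
    rw [List.map_cons, List.map_cons, evalStep_conj, Option.some.injEq] at h
    exact ⟨.inr (.formula (.conj ψ₁ ψ₂)) :: l, h.symm, by simp [encItem, encExpression, encFormula]⟩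
  by_cases hbox : c = .box
  · subst hbox
    rcases l with _ | ⟨m, _ | ⟨n, l⟩⟩
    · simp [evalStep, isSym] at h
    · simp [evalStep, isSym] at h
    by_cases hm : (value F m).1 = .sep
    swap
    · simp [evalStep, isSym, hm] at h
    by_cases hn : (value F n).1 = .single
    swap
    · simp [evalStep, isSym, hn] at h
    obtain ⟨k, rfl⟩ : ∃ k, m = .inl k := ⟨_, eq_inl_of_value hm⟩
    obtain ⟨ψ, rfl⟩ := eq_formula_of_value hn
    cases hr : look k (tables F).1 with
    | none => simp [evalStep, isSym, value, hr] at h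
    | some r =>
      obtain ⟨t, rfl, -⟩ := exists_of_look_σ hr
      rw [List.map_cons, List.map_cons, value, evalStep_box, Option.some.injEq] at h
      exact ⟨.inr (.formula (.box t ψ)) :: l, h.symm,
        by simp [encItem, encExpression, encFormula, encNat]⟩
  by_cases hsharp : c = .sharpening
  · subst hsharp
    rcases l with _ | ⟨m, _ | ⟨n, l⟩⟩
    · simp [evalStep, isSym] at h
    · simp [evalStep, isSym] at h
    by_cases hm : (value F m).1 = .sep
    swap
    · simp [evalStep, isSym, hm] at h
    by_cases hn : (value F n).1 = .sep
    swap
    · simp [evalStep, isSym, hn] at h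
    obtain ⟨k, rfl⟩ : ∃ k, m = .inl k := ⟨_, eq_inl_of_value hm⟩
    obtain ⟨k', rfl⟩ : ∃ k, n = .inl k := ⟨_, eq_inl_of_value hn⟩
    cases hr : look k (tables F).1 with
    | none => simp [evalStep, isSym, value, hr] at h
    | some r =>
      cases hr' : look k' (tables F).1 with
      | none =>
        -- `evalStep` looks up `k` in `τ` before `k'` in `σ`; it fails whatever that lookup gives.
        cases hu : look k (tables F).2.1 <;> simp [evalStep, isSym, value, hr, hr', hu] at h
      | some r' =>
        obtain ⟨t, rfl, -⟩ := exists_of_look_σ hr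
        obtain ⟨u, rfl, -⟩ := exists_of_look_σ hr'
        rw [List.map_cons, List.map_cons, value, value, evalStep_sharpening,
          Option.some.injEq] at h
        exact ⟨.inr (.sharpening t u) :: l, h.symm, by simp [encItem, encExpression, encNat]⟩
  simp [evalStep, isSym, hc, hatom, hneg, hconj, hbox, hsharp] at h

/-- The stack records a factorization of the suffix read so far into bit strings and expressions, so
success amounts to a parse. -/
theorem exists_of_evalTokens {w : List Symbol} {st : List Token}
    (h : evalTokens (tables F) (tokens w) = some st) :
    ∃ l : List (List Bool ⊕ Expression (Fin a) (Fin (s + 1))),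
      st = l.map (value F) ∧ w = l.flatMap encItem := by
  generalize hts : tokens w = ts at h
  induction ts generalizing w st with
  | nil =>
    simp only [evalTokens, List.foldr_nil, Option.some.injEq] at h
    exact ⟨[], h.symm, eq_nil_of_tokens_eq_nil hts⟩
  | cons t ts ih =>
    obtain ⟨r, rfl, hr, ht⟩ := eq_of_tokens_eq_cons hts
    rw [evalTokens_cons] at h
    cases hd : evalTokens (tables F) ts with
    | none => simp [hd] at h
    | some st' =>
      obtain ⟨l, rfl, rfl⟩ := ih hr hd
      rw [hd, ocase_some] at h
      obtain ⟨c, k⟩ := t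
      by_cases hc : c = .sep
      · subst hc
        rw [evalStep_sep, Option.some.injEq] at h
        exact ⟨.inl k :: l, h.symm, by simp [encItem, encBits]⟩
      · obtain rfl : k = [] := ht hc
        obtain ⟨l', rfl, hl'⟩ := exists_of_evalStep hc h
        exact ⟨l', rfl, by simp [hl']⟩

/-- The condition on a precisification, given by its binary index, or on all of them. -/
def pointBits : Option (Fin p) → Option (List Bool) := Option.map fun π => Computability.encodeNat π

theorem checkValue_value (pt : Option (Fin p)) (φ : Expression (Fin a) (Fin (s + 1))) :
    checkValue (pointBits pt) (value F (.inr φ)) = true ↔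
      match pt with
      | none => F.Models φ
      | some π => F.Sat π φ := by
  have hv : (value F (.inr φ)).1 ≠ .sep ∧
      (value F (.inr φ)).2 = bitRow {π | F.Sat π φ} := by
    cases φ <;> exact ⟨by simp [value], rfl⟩
  rw [checkValue, hv.2, isSym_of_ne hv.1]
  cases pt with
  | none =>
    simp only [Bool.not_false, Bool.true_and, pointBits, Option.map_none, ocase_none]
    exact all_bitRow
  | some π =>
    simp only [Bool.not_false, Bool.true_and, pointBits, Option.map_some, ocase_some,
      look_encodeNat, getElem?_bitRow, decide_eq_true_eq]
    rfl

theorem exists_of_checkValue {pt : Option (List Bool)}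
    {x : List Bool ⊕ Expression (Fin a) (Fin (s + 1))} (h : checkValue pt (value F x) = true) :
    ∃ φ, x = .inr φ := by
  cases x with
  | inl l => simp [checkValue, value] at h
  | inr φ => exact ⟨φ, rfl⟩

end Eval

end S4FStandpoint

/-! ### Correctness of the decision procedure on words -/

namespace S4FStandpoint

open PolyTime

theorem close_notMem_encBits (l : List Bool) : .close ∉ encBits l := by simp [encBits]

theorem close_notMem_flatMap_encBits (l : List (List Bool)) : .close ∉ l.flatMap encBits := by
  simp [encBits]

theorem close_notMem_encFormula {a s : ℕ} (ψ : Formula (Fin a) (Fin s)) :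
    .close ∉ encFormula ψ := by
  induction ψ <;> simp_all [encFormula, encNat, close_notMem_encBits]

theorem close_notMem_encExpression {a s : ℕ} (φ : Expression (Fin a) (Fin s)) :
    .close ∉ encExpression φ := by
  cases φ <;> simp [encExpression, encNat, close_notMem_encBits, close_notMem_encFormula]

theorem close_notMem_encPoint {p : ℕ} (pt : Option (Fin p)) : .close ∉ encPoint pt := by
  cases pt <;> simp [encPoint, encNat, close_notMem_encBits]

theorem encFamily_append {m n : ℕ} (X : Fin m → Set (Fin n)) (r : List Symbol) :
    encFamily X ++ r = (table X).flatMap encBits ++ .close :: r := by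
  simp [encFamily, encRows, table]

theorem sections_encStructure {a s p : ℕ}
    (F : StandpointStructure (Fin a) (Fin (s + 1)) 0 (Fin p)) (r : List Symbol) :
    sections (encStructure F ++ r) = (table F.σ).flatMap encBits :: (table F.τ).flatMap encBits ::
      (table F.γ).flatMap encBits :: sections r := by
  simp only [encStructure, List.append_assoc, encFamily_append, List.cons_append,
    sections_append_close (close_notMem_flatMap_encBits _)]

theorem sections_single {a s p : ℕ} (pt : Option (Fin p)) (φ : Expression (Fin a) (Fin s)) :
    sections (encPoint pt ++ encQuery (.single φ)) =
      [encPoint pt ++ .single :: encExpression φ] :=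
  sections_eq_singleton (by simp [close_notMem_encPoint, close_notMem_encExpression, encQuery])

/-- The final `close` of a theory produces an extra empty section; `checkSections` recognizes
theories by it. -/
theorem sections_theory {a s p : ℕ} (pt : Option (Fin p)) (T : List (Expression (Fin a) (Fin s))) :
    sections (encPoint pt ++ encQuery (.theory T)) =
      [encPoint pt ++ .theory :: T.flatMap encExpression, []] := by
  have := sections_append_close (w := encPoint pt ++ .theory :: T.flatMap encExpression)
    (by simp [close_notMem_encPoint, close_notMem_encExpression]) []
  simpa [encQuery, sections] using this

theorem tokens_encPoint {p : ℕ} (pt : Option (Fin p)) (r : List Symbol) :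
    tokens (encPoint pt ++ r) = match pt with
      | none => (.everywhere, []) :: tokens r
      | some π => (.at, []) :: (.sep, Computability.encodeNat π) :: tokens r := by
  cases pt with
  | none => exact tokens_cons_of_ne_bit (by simp) r
  | some π =>
    rw [encPoint, List.cons_append, tokens_cons_of_ne_bit (by simp), encNat, tokens_encBits]

section

variable {a s p : ℕ} {F : StandpointStructure (Fin a) (Fin (s + 1)) 0 (Fin p)}

theorem checkPointed_encPoint (pt : Option (Fin p)) (b : Bool) (r : List Symbol) :
    checkPointed (tables F) b (tokens (encPoint pt ++ r)) =
      checkQuery (tables F) (pointBits pt) b (tokens r) := by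
  rw [tokens_encPoint]
  cases pt with
  | none => simp [checkPointed, pointBits]
  | some π =>
    simp [checkPointed, pointBits, isSym, firstRow_tables, look_encodeNat]

theorem exists_of_checkPointed {b : Bool} {w : List Symbol}
    (h : checkPointed (tables F) b (tokens w) = true) : ∃ (pt : Option (Fin p)) (r : List Symbol),
      w = encPoint pt ++ r ∧ checkQuery (tables F) (pointBits pt) b (tokens r) = true := by
  rcases ht : tokens w with _ | ⟨t, ts⟩
  · simp [ht, checkPointed] at h
  obtain ⟨r, hw, hr, ht'⟩ := eq_of_tokens_eq_cons ht
  rw [ht, checkPointed, lcase_cons] at h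
  by_cases h₁ : t.1 = .everywhere
  · refine ⟨none, r, ?_, ?_⟩
    · rw [hw, ht' (by simp [h₁]), h₁]
      rfl
    · simpa [h₁, hr, pointBits] using h
  rw [isSym_of_ne h₁, cond_false, Bool.and_eq_true, isSym_eq_true] at h
  obtain ⟨h₂, h⟩ := h
  rcases ts with _ | ⟨n, ts⟩
  · simp at h
  obtain ⟨r', hw', hr', -⟩ := eq_of_tokens_eq_cons hr
  simp only [lcase_cons, Bool.and_eq_true, isSym_eq_true, firstRow_tables] at h
  obtain ⟨h₃, h⟩ := h
  cases hl : look n.2 (bitRow (F.σ 0)) with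
  | none => simp [hl] at h
  | some _ =>
    obtain ⟨π, hπ, -⟩ := exists_of_look_ofFn hl
    rw [hl, ocase_some] at h
    refine ⟨some π, r', ?_, ?_⟩
    · rw [hw, ht' (by simp [h₂]), h₂, hw', h₃, hπ]
      simp [encPoint, encNat, encBits]
    · rw [hr', pointBits, Option.map_some, ← hπ]
      exact h

theorem checkQuery_single (pt : Option (List Bool)) (φ : Expression (Fin a) (Fin (s + 1))) :
    checkQuery (tables F) pt false (tokens (.single :: encExpression φ)) =
      checkValue pt (value F (.inr φ)) := by
  have := evalTokens_flatMap (F := F) [φ]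
  rw [List.flatMap_singleton] at this
  simp [tokens_cons_of_ne_bit, checkQuery, this]

theorem checkQuery_theory (pt : Option (List Bool)) (T : List (Expression (Fin a) (Fin (s + 1)))) :
    checkQuery (tables F) pt true (tokens (.theory :: T.flatMap encExpression)) =
      T.all fun φ => checkValue pt (value F (.inr φ)) := by
  simp [tokens_cons_of_ne_bit, checkQuery, evalTokens_flatMap, Function.comp_def]

/-- `checkValue` rejects bare bit strings, so all items left on the stack are expressions. -/
theorem exists_of_checkQuery {pt : Option (List Bool)} {b : Bool} {w : List Symbol}
    (h : checkQuery (tables F) pt b (tokens w) = true) :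
    (b = false ∧ ∃ φ : Expression (Fin a) (Fin (s + 1)), w = .single :: encExpression φ) ∨
    (b = true ∧ ∃ T : List (Expression (Fin a) (Fin (s + 1))),
      w = .theory :: T.flatMap encExpression) := by
  rcases ht : tokens w with _ | ⟨t, ts⟩
  · simp [ht, checkQuery] at h
  obtain ⟨r, rfl, hr, ht'⟩ := eq_of_tokens_eq_cons ht
  rw [ht, checkQuery, lcase_cons, ← hr] at h
  cases he : evalTokens (tables F) (tokens r) with
  | none => simp [he] at h
  | some st =>
    obtain ⟨l, rfl, rfl⟩ := exists_of_evalTokens he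
    rw [he, ocase_some] at h
    cases b
    · simp only [cond_false, Bool.and_eq_true, isSym_eq_true] at h
      obtain ⟨h₁, h⟩ := h
      rcases l with _ | ⟨x, l⟩
      · simp at h
      simp only [List.map_cons, lcase_cons, Bool.and_eq_true, List.isEmpty_iff,
        List.map_eq_nil_iff] at h
      obtain ⟨rfl, h⟩ := h
      obtain ⟨φ, rfl⟩ := exists_of_checkValue h
      exact .inl ⟨rfl, φ, by simp [ht' (by simp [h₁]), h₁, encItem]⟩
    · simp only [cond_true, Bool.and_eq_true, isSym_eq_true, List.all_map, List.all_eq_true] at h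
      obtain ⟨h₁, h⟩ := h
      have : ∃ T : List (Expression (Fin a) (Fin (s + 1))), l = T.map .inr := by
        clear he hr ht
        induction l with
        | nil => exact ⟨[], rfl⟩
        | cons x l ih =>
          obtain ⟨φ, rfl⟩ := exists_of_checkValue (h x (by simp))
          obtain ⟨T, rfl⟩ := ih fun y hy => h y (by simp [hy])
          exact ⟨φ :: T, rfl⟩
      obtain ⟨T, rfl⟩ := this
      exact .inr ⟨rfl, T, by simp [ht' (by simp [h₁]), h₁, List.flatMap_map, encItem]⟩

theorem checkSections_tables (w : List Symbol) (l : List (List Symbol)) :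
    checkSections ((table F.σ).flatMap encBits :: (table F.τ).flatMap encBits ::
      (table F.γ).flatMap encBits :: w :: l) =
      (lcase l true (fun w l => w.isEmpty && l.isEmpty) &&
        checkPointed (tables F) (!l.isEmpty) (tokens w)) := by
  have := validTables_tables F
  rw [tables] at this
  simp only [checkSections, lcase_cons, rows_flatMap_encBits, this, Bool.true_and]
  rfl

end

theorem checkSections_encode (x : ModelCheckingInstance) :
    checkSections (sections x.encode) = true ↔ x.Holds := by
  obtain ⟨a, s, p, F, q, pt⟩ := x
  rw [ModelCheckingInstance.encode, List.append_assoc, sections_encStructure]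
  cases q with
  | single φ =>
    rw [sections_single, checkSections_tables]
    simp only [lcase_nil, List.isEmpty_nil, Bool.not_true, Bool.true_and, checkPointed_encPoint,
      checkQuery_single, checkValue_value]
    cases pt <;> rfl
  | theory T =>
    rw [sections_theory, checkSections_tables]
    simp only [lcase_cons, List.isEmpty_nil, List.isEmpty_cons, Bool.not_false, Bool.true_and,
      checkPointed_encPoint, checkQuery_theory, checkValue_value, List.all_eq_true]
    cases pt <;> rfl

/-- The four kinds of test determine the tables, the point, the query and the absence of further
sections. As `sections` is never empty, an exhausted list of sections excludes any further `close`.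
-/
theorem exists_encode_eq {w : List Symbol} (h : checkSections (sections w) = true) :
    ∃ x : ModelCheckingInstance, x.encode = w := by
  rcases hs : sections w with _ | ⟨w₁, _ | ⟨w₂, _ | ⟨w₃, _ | ⟨w₄, l⟩⟩⟩⟩ <;>
    rw [hs] at h <;> simp only [checkSections, lcase_cons, lcase_nil, Bool.false_eq_true,
      Bool.and_eq_true] at h
  obtain ⟨h₁, h₂, h₃, h₄, h₅, h₆⟩ := h
  obtain ⟨a, s, p, F, hF⟩ := exists_of_validTables h₄
  rw [hF] at h₆
  simp only [tables, Prod.mk.injEq] at hF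
  obtain ⟨pt, r, hr, h₆⟩ := exists_of_checkPointed h₆
  have e₁ := eq_of_rows h₁
  have e₂ := eq_of_rows h₂
  have e₃ := eq_of_rows h₃
  rw [hF.1] at e₁
  rw [hF.2.1] at e₂
  rw [hF.2.2] at e₃
  obtain ⟨h, -⟩ | ⟨r₁, rfl, hs₁⟩ := eq_of_sections_eq_cons hs
  · simp at h
  obtain ⟨h, -⟩ | ⟨r₂, rfl, hs₂⟩ := eq_of_sections_eq_cons hs₁
  · simp at h
  obtain ⟨h, -⟩ | ⟨r₃, rfl, hs₃⟩ := eq_of_sections_eq_cons hs₂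
  · simp at h
  have key : ∀ q : Query (Fin a) (Fin (s + 1)), r₃ = encPoint pt ++ encQuery q →
      (⟨a, s, p, F, q, pt⟩ : ModelCheckingInstance).encode =
        w₁ ++ .close :: (w₂ ++ .close :: (w₃ ++ .close :: r₃)) := by
    intro q hq
    simp only [ModelCheckingInstance.encode, encStructure, List.append_assoc, encFamily_append,
      List.cons_append]
    rw [← e₁, ← e₂, ← e₃, hq]
  rcases exists_of_checkQuery h₆ with ⟨hb, φ, rfl⟩ | ⟨hb, T, rfl⟩
  · obtain rfl : l = [] := by simpa using hb
    obtain ⟨-, rfl⟩ | ⟨r₄, rfl, hs₄⟩ := eq_of_sections_eq_cons hs₃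
    · exact ⟨_, key (.single φ) (by rw [hr]; rfl)⟩
    · exact absurd hs₄ (sections_ne_nil _)
  · rcases l with _ | ⟨w, l⟩
    · simp at hb
    simp only [lcase_cons, Bool.and_eq_true, List.isEmpty_iff] at h₅
    obtain ⟨rfl, rfl⟩ := h₅
    obtain ⟨h, -⟩ | ⟨r₄, rfl, hs₄⟩ := eq_of_sections_eq_cons hs₃
    · simp at h
    obtain ⟨-, rfl⟩ | ⟨r₅, rfl, hs₅⟩ := eq_of_sections_eq_cons hs₄
    · exact ⟨_, key (.theory T) (by rw [hr]; simp [encQuery])⟩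
    · exact absurd hs₅ (sections_ne_nil _)

theorem mem_modelCheckingProblem_iff (w : List Symbol) :
    w ∈ modelCheckingProblem ↔ checkSections (sections w) = true := by
  constructor
  · rintro ⟨x, rfl, hx⟩
    exact (checkSections_encode x).2 hx
  · intro h
    obtain ⟨x, rfl⟩ := exists_encode_eq h
    exact ⟨x, rfl, (checkSections_encode x).1 h⟩

end S4FStandpoint

/-! ### From polynomial-time functions to Turing machines -/

namespace PolyTime

open TreeEnc Turing S4FStandpoint

section Machine

variable {I : Type}

/-- Pop from the input stack into the register. -/
def popInput : WordProg I := .pop .input fun r o => (o, r.2)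

theorem run_popInput (v : Option I) (o : Option Bool) (i : List I) (w : Work → List Bool) :
    (popInput (I := I)).RunLE ((v, o), allStacks i w) 1 ((i.head?, o), allStacks i.tail w) := by
  rw [← update_allStacks_input i i.tail]
  exact (Prog.Run.pop (Γ := StackSymbol I) .input _ _ _).le

/-- Push the serialization of the symbol in the register onto stack `a`. -/
def pushSymbol [TreeEnc I] : WordProg I := .switch fun r =>
  match r.1 with
  | none => loadW none
  | some s => pushList (tree s).ser

/-- Read the input and push the encoding of the list of its symbols, in reverse order. -/
def readInput [TreeEnc I] : WordProg I :=
  (pushW .a fun _ => false).seq (popInput.seq (.loop (fun r => r.1.isSome)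
    (pushSymbol.seq ((pushW .a fun _ => true).seq popInput))))

/-- The initial `false` is the code of the empty list, and every symbol read is put in front of the
list so far; this reverses the word. -/
theorem run_readInput [TreeEnc I] {c : ℕ} (hc : ∀ s : I, sz s ≤ c) (w : List I) : ∃ o,
    (readInput (I := I)).RunLE ((none, none), allStacks w (work [] [] [] []))
      (w.length * (c + 5) + 3) ((none, o), allStacks [] (work (tree w.reverse).ser [] [] [])) := by
  have key : ∀ (w l : List I) (o : Option Bool), ∃ o', Prog.RunLE (.loop (fun r => r.1.isSome)
        (pushSymbol.seq ((pushW .a fun _ => true).seq popInput)))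
      ((w.head?, o), allStacks w.tail (work (tree l).ser [] [] [])) (w.length * (c + 5) + 1)
      ((none, o'), allStacks [] (work (tree (w.reverse ++ l)).ser [] [] [])) := by
    intro w
    induction w with
    | nil => exact fun l o => ⟨o, (Prog.RunLE.loop_done _ rfl).mono (by simp)⟩
    | cons s w ih =>
      intro l o
      obtain ⟨o₁, e₁⟩ := RunA.pushList (I := I) (tree s).ser (tree l).ser o
      have e₁ := Prog.RunLE.switch (s := ((some s, o), allStacks w (work (tree l).ser [] [] [])))
        (f := fun r : Option I × Option Bool => match r.1 with
          | none => loadW none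
          | some s => pushList (tree s).ser) (e₁ (some s) w)
      obtain ⟨o₂, e₂⟩ := RunA.pushW (I := I) true ((tree s).ser ++ (tree l).ser) o₁
      have e₃ := run_popInput (some s) o₂ w
        (work (true :: ((tree s).ser ++ (tree l).ser)) [] [] [])
      obtain ⟨o₃, e₄⟩ := ih (s :: l) o₂
      refine ⟨o₃, ?_⟩
      have := Prog.RunLE.loop_step (c := fun r : Option I × Option Bool => r.1.isSome)
        (s₁ := ((some s, o), allStacks w (work (tree l).ser [] [] []))) rfl
        (e₁.seq ((e₂ (some s) w).seq e₃)) e₄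
      rw [List.reverse_cons, List.append_assoc]
      refine this.mono ?_
      have := hc s
      rw [sz] at this
      simp only [Tree.length_ser, List.length_cons, Nat.add_mul]
      omega
  obtain ⟨o₁, e₁⟩ := RunA.pushW (I := I) false [] none
  have e₂ := run_popInput none o₁ w (work [false] [] [] [])
  obtain ⟨o₃, e₃⟩ := key w [] o₁
  rw [List.append_nil] at e₃
  exact ⟨o₃, ((e₁ none w).seq (e₂.seq e₃)).mono (by omega)⟩

/-- Replace the encoding of a Boolean by this Boolean and reset the register. -/
def writeOutput : WordProg I :=
  (branch ((popW .a).seq ((popW .a).seq (pushW .a fun _ => true))) (pushW .a fun _ => false)).seq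
    (.load fun _ => (none, none))

/-- The code of `true` has two bits after the first, which must be removed. The register is reset
because `haltList` prescribes the initial one. -/
theorem run_writeOutput (b : Bool) (v : Option I) (o : Option Bool) (i : List I) :
    (writeOutput (I := I)).RunLE ((v, o), allStacks i (work (tree b).ser [] [] [])) 6
      ((none, none), allStacks i (work [b] [] [] [])) := by
  have h : RunA (I := I) (branch ((popW .a).seq ((popW .a).seq (pushW .a fun _ => true)))
      (pushW .a fun _ => false)) (tree b).ser 5 [b] := by
    cases b
    · exact (RunA.branch_false (RunA.pushW false []) _).mono (by omega)
    · exact RunA.branch_true ((RunA.popW false [false]).seq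
        ((RunA.popW false []).seq (RunA.pushW true []))) _
  obtain ⟨o', h⟩ := h o
  exact (h v i).seq (Prog.Run.load _ _ _).le

/-- The Turing machine that executes a program. -/
noncomputable def machine [Fintype I] (p : WordProg I) : FinTM2 where
  K := Stack
  k₀ := .input
  k₁ := .work .a
  Γ := StackSymbol I
  Λ := Option p.Label
  main := some p.entry
  σ := Option I × Option Bool
  initialState := (none, none)
  Γk₀Fin := inferInstanceAs (Fintype I)
  m
    | none => .halt
    | some l => p.code some none l

theorem initList_machine [Fintype I] (p : WordProg I) (w : List I) :
    initList (machine p) w =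
      ⟨some (some p.entry), (none, none), allStacks w (work [] [] [] [])⟩ := by
  unfold initList
  congr 1
  funext k
  rcases k with _ | _ | _ | _ | _ <;> rfl

theorem haltList_machine [Fintype I] (p : WordProg I) (b : Bool) :
    haltList (machine p) [b] = ⟨none, (none, none), allStacks [] (work [b] [] [] [])⟩ := by
  unfold haltList
  congr 1
  funext k
  rcases k with _ | _ | _ | _ | _ <;> rfl

/-- The additional step executes `halt` at the exit label `none`. -/
theorem iterate_step_machine [Fintype I] {p : WordProg I} {w : List I} {b : Bool} {n : ℕ}
    (h : p.RunLE ((none, none), allStacks w (work [] [] [] [])) n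
      ((none, none), allStacks [] (work [b] [] [] []))) :
    ∃ m ≤ n + 1, (flip bind (machine p).step)^[m] (some (initList (machine p) w)) =
      some (haltList (machine p) [b]) := by
  obtain ⟨m, hm, h⟩ := h
  refine ⟨m + 1, by omega, ?_⟩
  rw [Nat.add_comm, Function.iterate_add_apply, initList_machine, haltList_machine]
  have := h.iterate_step (M := (machine p).m) some none fun _ => rfl
  exact (congrArg _ this).trans rfl

end Machine

/-- A language with a polynomial-time decision procedure, applied to the reversed word, is in the
class `P`. -/
theorem mem_classP {Γ : Type} [Fintype Γ] [TreeEnc Γ] {L : Language Γ} {f : List Γ → Bool}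
    (hf : Poly f) (hL : ∀ w, w ∈ L ↔ f w.reverse = true) : L ∈ ClassP Γ := by
  obtain ⟨p, T, h⟩ := hf
  -- The alphabet is finite, so symbol codes have bounded size and the code of a word is linear in
  -- its length.
  let c := Finset.univ.sup fun s : Γ => sz s
  have hc : ∀ s : Γ, sz s ≤ c := fun s =>
    Finset.le_sup (f := fun s : Γ => sz s) (Finset.mem_univ s)
  have hsz : ∀ w : List Γ, sz w ≤ w.length * (c + 1) + 1 := by
    intro w
    induction w with
    | nil => simp
    | cons s w ih =>
      have := hc s
      simp only [sz_cons, List.length_cons, Nat.add_mul] at *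
      omega
  let q : WordProg Γ := readInput.seq ((p Γ).seq writeOutput)
  let U : Polynomial ℕ := .X * (.C c + 5) + T.comp (.X * (.C c + 1) + 1) + 10
  have key : ∀ w : List Γ, ∃ m ≤ U.eval w.length,
      (flip bind (machine q).step)^[m] (some (initList (machine q) w)) =
        some (haltList (machine q) [f w.reverse]) := by
    intro w
    obtain ⟨o₁, e₁⟩ := run_readInput hc w
    obtain ⟨o₂, e₂⟩ := (h w.reverse).1 Γ [] o₁
    have e₂ := e₂ none []
    rw [List.append_nil, List.append_nil] at e₂
    have e₃ := run_writeOutput (f w.reverse) none o₂ ([] : List Γ)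
    obtain ⟨m, hm, e⟩ := iterate_step_machine (e₁.seq (e₂.seq e₃))
    refine ⟨m, hm.trans ?_, e⟩
    have := eval_mono T (show sz w.reverse ≤ w.length * (c + 1) + 1 by
      rw [sz_reverse]; exact hsz w)
    simp only [U, Polynomial.eval_add, Polynomial.eval_mul, Polynomial.eval_comp,
      Polynomial.eval_X, Polynomial.eval_C, Polynomial.eval_one, Polynomial.eval_ofNat]
    omega
  have hw : ∀ w, @decide (w ∈ L) (Classical.propDecidable _) = f w.reverse := fun w => by
    rw [Bool.eq_iff_iff, @decide_eq_true_eq _ (Classical.propDecidable _), hL]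
  refine ⟨{
    tm := machine q
    inputAlphabet := Equiv.refl Γ
    outputAlphabet := Equiv.refl Bool
    time := U
    -- The number of steps is a datum of the structure, whereas `key` only asserts its existence.
    outputsFun := fun w => ⟨⟨Classical.choose (key w), ?_⟩, (Classical.choose_spec (key w)).1⟩ }⟩
  have e := (Classical.choose_spec (key w)).2
  have hin : List.map (Equiv.refl Γ).invFun (id w) = w := List.map_id w
  have hout : List.map (Equiv.refl Bool).invFun (Computability.encodeBool
      (@decide (w ∈ L) (Classical.propDecidable _))) = [f w.reverse] := by
    rw [hw]
    rfl
  exact (congrArg (fun l => (flip bind (machine q).step)^[Classical.choose (key w)]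
    (some (initList (machine q) l))) hin).trans
    (e.trans (congrArg (fun l => some (haltList (machine q) l)) hout).symm)

end PolyTime

theorem mainTheorem9 :
    S4FStandpoint.modelCheckingProblem ∈ S4FStandpoint.ClassP S4FStandpoint.Symbol := by
  -- The `reverse` undoes the reversal that occurs when the input is read.
  have h : PolyTime.Poly fun w : List S4FStandpoint.Symbol =>
      S4FStandpoint.checkSections (S4FStandpoint.sections w.reverse) :=
    S4FStandpoint.poly_checkSections.comp (by fun_prop)
  refine PolyTime.mem_classP h fun w => ?_
  rw [List.reverse_reverse]
  exact S4FStandpoint.mem_modelCheckingProblem_iff w
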